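/- Let $\mathcal X,\mathcal Y,\mathcal Z$ be finite sets and let $W(z|x,y)$ be a two-user discrete memoryless multiple access channel in which either user may be adversarial. An $(N_1,N_2,n)$ adversary identifying code consists of encoders $f_1:\{1,\dots,N_1\}\to\mathcal X^n$ and $f_2:\{1,\dots,N_2\}\to\mathcal Y^n$ and a decoder $\phi:\mathcal Z^n\to(\{1,\dots,N_1\}\times\{1,\dots,N_2\})\cup\{\mathbf 1,\mathbf 2\}$. Its error probability $P_e$ is the maximum of \[ \frac1{N_1N_2}\sum_{m_1,m_2}W^n\big(\phi\ne(m_1,m_2)\,\big|\,f_1(m_1),f_2(m_2)\big), \] \[ \max_{\mathbf x\in\mathcal X^n}\frac1{N_2}\sum_{m_2}W^n\big(\phi\notin(\{1,\dots,N_1\}\times\{m_2\})\cup\{\mathbf 1\}\,\big|\,\mathbf x,f_2(m_2)\big), \] \[ \max_{\mathbf y\in\mathcal Y^n}\frac1{N_1}\sum_{m_1}W^n\big(\phi\notin(\{m_1\}\times\{1,\dots,N_2\})\cup\{\mathbf 2\}\,\big|\,f_1(m_1),\mathbf y\big). \] A pair $(R_1,R_2)$ of nonnegative reals is achievable if there are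 $(\lfloor2^{nR_1}\rfloor,\lfloor2^{nR_2}\rfloor,n)$ adversary identifying codes, $n=1,2,\dots$, with $P_e\to0$; the capacity region $\mathcal C$ is the closure of the set of achievable pairs. For distributions $P_1$ on $\mathcal X$ and $P_2$ on $\mathcal Y$, let $\mathcal P(P_1,P_2)$ be the set of joint distributions of random variables $(X,Y,\tilde X,\tilde Y,Z)$ on $\mathcal X\times\mathcal Y\times\mathcal X\times\mathcal Y\times\mathcal Z$ such that $P_{X\tilde YZ}=P_1\times P_{\tilde Y}\times W$ for some distribution $P_{\tilde Y}$ on $\mathcal Y$ and $P_{\tilde XYZ}=P_{\tilde X}\times P_2\times W$ for some distribution $P_{\tilde X}$ on $\mathcal X$. With all information quantities in bits, let $\mathcal R_1(P_1,P_2)$ be the set of pairs of nonnegative reals $(R_1,R_2)$ with \[ R_1\le\min_{\mathcal P(P_1,P_2)}I(X;Z),\qquad R_2\le\min_{\mathcal P(P_1,P_2):\,X\perp Y}I(Y;Z|X), \] and let $\mathcal R_2(P_1,P_2)$ be the set of pairs of nonnegative reals with \[ R_1\le\min_{\mathcal P(P_1,P_2):\,X\perp Y}I(X;Z|Y),\qquad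 R_2\le\min_{\mathcal P(P_1,P_2)}I(Y;Z), \] where $X\perp Y$ means that $X$ and $Y$ are independent. Theorem. If $\mathcal C$ has non-empty interior, then the convex closure (closed convex hull) of $\bigcup_{P_1,P_2}\big(\mathcal R_1(P_1,P_2)\cup\mathcal R_2(P_1,P_2)\big)$, the union being over all distributions $P_1$ on $\mathcal X$ and $P_2$ on $\mathcal Y$, is contained in $\mathcal C$. -/

import Mathlib

noncomputable section

open scoped Classical

/-! Finite information measures. A distribution on a finite type `Ω` is a point `p` of
`stdSimplex ℝ Ω`; random variables are functions on `Ω`. All logarithms have base `2`. -/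

/-- The law (push-forward) of the random variable `f` under `p`. -/
def law {Ω A : Type*} [Fintype Ω] (p : Ω → ℝ) (f : Ω → A) (a : A) : ℝ :=
  ∑ ω, if f ω = a then p ω else 0

/-- Independence of the random variables `f` and `g` under `p`. -/
def IndepVars {Ω A B : Type*} [Fintype Ω] (p : Ω → ℝ) (f : Ω → A) (g : Ω → B) : Prop :=
  ∀ a b, law p (fun ω => (f ω, g ω)) (a, b) = law p f a * law p g b

/-- Mutual information `I(f; g)` in bits (terms of zero probability contribute `0`). -/
def mutualInfo {Ω A B : Type*} [Fintype Ω] [Fintype A] [Fintype B]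
    (p : Ω → ℝ) (f : Ω → A) (g : Ω → B) : ℝ :=
  ∑ a, ∑ b, law p (fun ω => (f ω, g ω)) (a, b) *
    Real.logb 2 (law p (fun ω => (f ω, g ω)) (a, b) / (law p f a * law p g b))

/-- Conditional mutual information `I(f; g | h)` in bits
(terms of zero probability contribute `0`). -/
def condMutualInfo {Ω A B C : Type*} [Fintype Ω] [Fintype A] [Fintype B] [Fintype C]
    (p : Ω → ℝ) (f : Ω → A) (g : Ω → B) (h : Ω → C) : ℝ :=
  ∑ a, ∑ b, ∑ c, law p (fun ω => (f ω, g ω, h ω)) (a, b, c) *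
    Real.logb 2 (law p (fun ω => (f ω, g ω, h ω)) (a, b, c) * law p h c /
      (law p (fun ω => (f ω, h ω)) (a, c) * law p (fun ω => (g ω, h ω)) (b, c)))

/-! The multiple access channel with byzantine users. -/

/-- `W` is a discrete memoryless MAC: `W x y z` is the probability of the output `z` on the
inputs `x` (user 1) and `y` (user 2). -/
def IsMAC {X Y Z : Type*} [Fintype Z] (W : X → Y → Z → ℝ) : Prop :=
  ∀ x y, W x y ∈ stdSimplex ℝ Z

/-- Probability `Wⁿ(E | x, y)` of a set `E` of output sequences under the `n`-fold product
channel. -/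
def prodProb {X Y Z : Type*} [Fintype Z] (W : X → Y → Z → ℝ) {n : ℕ}
    (x : Fin n → X) (y : Fin n → Y) (E : Set (Fin n → Z)) : ℝ :=
  ∑ z : Fin n → Z, if z ∈ E then ∏ t, W (x t) (y t) (z t) else 0

/-- Decoder outputs: a pair of messages, or the identity of an adversarial user. -/
inductive Output (N₁ N₂ : ℕ) : Type
  | msgs (m₁ : Fin N₁) (m₂ : Fin N₂) : Output N₁ N₂
  | blameOne : Output N₁ N₂
  | blameTwo : Output N₁ N₂

/-- A deterministic `(N₁, N₂, n)` adversary identifying code. -/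
structure Code (X Y Z : Type*) (N₁ N₂ n : ℕ) where
  /-- encoder of user 1 -/
  enc₁ : Fin N₁ → Fin n → X
  /-- encoder of user 2 -/
  enc₂ : Fin N₂ → Fin n → Y
  /-- decoder -/
  dec : (Fin n → Z) → Output N₁ N₂

namespace Code

variable {X Y Z : Type*} {N₁ N₂ n : ℕ}

/-- Error event when both users are honest. -/
def errHonest (c : Code X Y Z N₁ N₂ n) (m₁ : Fin N₁) (m₂ : Fin N₂) : Set (Fin n → Z) :=
  {z | c.dec z ≠ Output.msgs m₁ m₂}

/-- Error event when user 1 is adversarial and user 2 sends `m₂`. -/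
def errMalOne (c : Code X Y Z N₁ N₂ n) (m₂ : Fin N₂) : Set (Fin n → Z) :=
  {z | ¬ ((∃ m₁, c.dec z = Output.msgs m₁ m₂) ∨ c.dec z = Output.blameOne)}

/-- Error event when user 2 is adversarial and user 1 sends `m₁`. -/
def errMalTwo (c : Code X Y Z N₁ N₂ n) (m₁ : Fin N₁) : Set (Fin n → Z) :=
  {z | ¬ ((∃ m₂, c.dec z = Output.msgs m₁ m₂) ∨ c.dec z = Output.blameTwo)}

variable [Fintype Z]

/-- Average probability of error when both users are honest. -/
def peHonest (W : X → Y → Z → ℝ) (c : Code X Y Z N₁ N₂ n) : ℝ :=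
  1 / ((N₁ : ℝ) * (N₂ : ℝ)) *
    ∑ m₁, ∑ m₂, prodProb W (c.enc₁ m₁) (c.enc₂ m₂) (c.errHonest m₁ m₂)

/-- Average probability of error under the worst input sequence of an adversarial user 1
(a supremum over a finite set, hence a maximum). -/
def peMalOne (W : X → Y → Z → ℝ) (c : Code X Y Z N₁ N₂ n) : ℝ :=
  ⨆ x : Fin n → X, 1 / (N₂ : ℝ) * ∑ m₂, prodProb W x (c.enc₂ m₂) (c.errMalOne m₂)

/-- Average probability of error under the worst input sequence of an adversarial user 2
(a supremum over a finite set, hence a maximum). -/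
def peMalTwo (W : X → Y → Z → ℝ) (c : Code X Y Z N₁ N₂ n) : ℝ :=
  ⨆ y : Fin n → Y, 1 / (N₁ : ℝ) * ∑ m₁, prodProb W (c.enc₁ m₁) y (c.errMalTwo m₁)

/-- Average probability of error of a code. -/
def pe (W : X → Y → Z → ℝ) (c : Code X Y Z N₁ N₂ n) : ℝ :=
  max (peHonest W c) (max (peMalOne W c) (peMalTwo W c))

end Code

/-- `(R.1, R.2)` is an achievable (nonnegative) rate pair: there are
`(⌊2^(n R₁)⌋, ⌊2^(n R₂)⌋, n)` codes whose probability of error tends to `0`. -/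
def Achievable {X Y Z : Type*} [Fintype Z] (W : X → Y → Z → ℝ) (R : ℝ × ℝ) : Prop :=
  0 ≤ R.1 ∧ 0 ≤ R.2 ∧
    ∃ c : ∀ n : ℕ, Code X Y Z ⌊(2 : ℝ) ^ ((n : ℝ) * R.1)⌋₊ ⌊(2 : ℝ) ^ ((n : ℝ) * R.2)⌋₊ n,
      Filter.Tendsto (fun n => (c n).pe W) Filter.atTop (nhds 0)

/-- Capacity region of communication with adversary identification. -/
def capacityRegion {X Y Z : Type*} [Fintype Z] (W : X → Y → Z → ℝ) : Set (ℝ × ℝ) :=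
  closure {R | Achievable W R}

/-! The inner bound. -/

/-- Outcome space of the five random variables `(X, Y, X̃, Ỹ, Z)`. -/
abbrev Joint (X Y Z : Type*) := X × Y × X × Y × Z

namespace Joint

variable {X Y Z : Type*}

/-- the random variable `X` -/
def rX (ω : Joint X Y Z) : X := ω.1
/-- the random variable `Y` -/
def rY (ω : Joint X Y Z) : Y := ω.2.1
/-- the random variable `X̃` -/
def rX' (ω : Joint X Y Z) : X := ω.2.2.1
/-- the random variable `Ỹ` -/
def rY' (ω : Joint X Y Z) : Y := ω.2.2.2.1
/-- the random variable `Z` -/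
def rZ (ω : Joint X Y Z) : Z := ω.2.2.2.2

end Joint

open Joint in
/-- The set `𝒫(P₁, P₂)` of joint distributions of `(X, Y, X̃, Ỹ, Z)` with
`P_{XỸZ} = P₁ × P_Ỹ × W` for some `P_Ỹ` and `P_{X̃YZ} = P_X̃ × P₂ × W` for some `P_X̃`. -/
def attackSet {X Y Z : Type*} [Fintype X] [Fintype Y] [Fintype Z] (W : X → Y → Z → ℝ)
    (P₁ : X → ℝ) (P₂ : Y → ℝ) : Set (Joint X Y Z → ℝ) :=
  {p | p ∈ stdSimplex ℝ (Joint X Y Z) ∧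
    (∃ Q ∈ stdSimplex ℝ Y, ∀ x y z,
      law p (fun ω => (rX ω, rY' ω, rZ ω)) (x, y, z) = P₁ x * Q y * W x y z) ∧
    (∃ Q ∈ stdSimplex ℝ X, ∀ x y z,
      law p (fun ω => (rX' ω, rY ω, rZ ω)) (x, y, z) = Q x * P₂ y * W x y z)}

open Joint in
/-- The rate pairs with `R₁ ≤ min I(X; Z)` over `𝒫(P₁, P₂)` and
`R₂ ≤ min I(Y; Z | X)` over the elements of `𝒫(P₁, P₂)` with `X` and `Y` independent. -/
def rateRegion₁ {X Y Z : Type*} [Fintype X] [Fintype Y] [Fintype Z] (W : X → Y → Z → ℝ)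
    (P₁ : X → ℝ) (P₂ : Y → ℝ) : Set (ℝ × ℝ) :=
  {R | 0 ≤ R.1 ∧ 0 ≤ R.2 ∧
    (∀ p ∈ attackSet W P₁ P₂, R.1 ≤ mutualInfo p rX rZ) ∧
    (∀ p ∈ attackSet W P₁ P₂, IndepVars p rX rY → R.2 ≤ condMutualInfo p rY rZ rX)}

open Joint in
/-- The rate pairs with `R₁ ≤ min I(X; Z | Y)` over the elements of `𝒫(P₁, P₂)` with `X` and
`Y` independent, and `R₂ ≤ min I(Y; Z)` over `𝒫(P₁, P₂)`. -/
def rateRegion₂ {X Y Z : Type*} [Fintype X] [Fintype Y] [Fintype Z] (W : X → Y → Z → ℝ)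
    (P₁ : X → ℝ) (P₂ : Y → ℝ) : Set (ℝ × ℝ) :=
  {R | 0 ≤ R.1 ∧ 0 ≤ R.2 ∧
    (∀ p ∈ attackSet W P₁ P₂, IndepVars p rX rY → R.1 ≤ condMutualInfo p rX rZ rY) ∧
    (∀ p ∈ attackSet W P₁ P₂, R.2 ≤ mutualInfo p rY rZ)}

end

/-! Exchanging the users turns `rateRegion₂` into `rateRegion₁`, and time sharing makes the capacity
region convex, so it is enough to approach every pair of `rateRegion₁`.

Codewords are drawn memorylessly from P₁ and P₂. A message of user 1 is a candidate if its codeword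
and the output look like an attack by user 2 (`ExplainedTwo`); candidates of user 2 are defined
symmetrically (`ExplainedOne`). When codewords x and y are both candidates for z, the joint type of
x, y, z and the two explaining sequences nearly lies in the attack set. By compactness
(`exists_separation`), I(x;z) is then almost R₁ or more, and if y also looks independent of x,
I(y;x,z) is almost R₂ or more. A codeword unrelated to z meets such a bound with exponentially small
probability (`prob_empInfo_ge_le`), so below these rates wrong messages are excluded by a union
bound. The decoder `decideVerdict` looks for a unique candidate of user 1, then for a unique
compatible candidate of user 2; the step that fails tells whom to blame.

The code is deterministic and must withstand exponentially many attack sequences. Here the interior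
of the capacity region enters: it yields an achievable pair with both rates positive, and a code of
these rates on a small fraction κ of the block transmits keys that select the codebooks used on the
rest. This prefix delivers the honest user's key or blames the adversary. For a fixed attack the
errors of the codebooks of different keys are independent, so n² keys are enough for a Chernoff
bound to beat the union over all attacks (`exists_codebooks_one`, `exists_codebooks_two`). An
adversarial user 1 chooses its own key; the error is therefore summed over its keys, whose number is
kept below a small exponential. Letting κ tend to 0 gives the theorem. -/

noncomputable section
open scoped Classical
open Finset

/-! Finite probability: expectations, product laws, exponential bounds. -/

section FiniteProbability

variable {α β ι : Type*}

/-- The expectation of `f` under the weights `w`. -/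
def avg [Fintype α] (w f : α → ℝ) : ℝ := ∑ a, w a * f a

/-- The probability of the event `E` under the weights `w`. -/
def prob [Fintype α] (w : α → ℝ) (E : α → Prop) : ℝ := avg w fun a => if E a then 1 else 0

/-- The weights of the product law. -/
def piW [Fintype ι] (w : ι → α → ℝ) (c : ι → α) : ℝ := ∏ i, w i (c i)

variable [Fintype α] [Fintype β] [Fintype ι] [DecidableEq ι]

theorem avg_mono {w f g : α → ℝ} (hw : w ∈ stdSimplex ℝ α) (h : ∀ a, f a ≤ g a) :
    avg w f ≤ avg w g :=
  sum_le_sum fun a _ => mul_le_mul_of_nonneg_left (h a) (hw.1 a)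

theorem avg_const {w : α → ℝ} (hw : w ∈ stdSimplex ℝ α) (r : ℝ) : avg w (fun _ => r) = r := by
  rw [avg, ← sum_mul, hw.2, one_mul]

theorem avg_le_const {w f : α → ℝ} (hw : w ∈ stdSimplex ℝ α) {r : ℝ} (h : ∀ a, f a ≤ r) :
    avg w f ≤ r :=
  (avg_mono hw h).trans (avg_const hw r).le

theorem avg_nonneg {w f : α → ℝ} (hw : w ∈ stdSimplex ℝ α) (h : ∀ a, 0 ≤ f a) : 0 ≤ avg w f :=
  sum_nonneg fun a _ => mul_nonneg (hw.1 a) (h a)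

omit [Fintype β] in
theorem avg_sum {w : α → ℝ} (s : Finset β) (f : β → α → ℝ) :
    avg w (fun a => ∑ b ∈ s, f b a) = ∑ b ∈ s, avg w (f b) := by
  simp only [avg, mul_sum]
  exact sum_comm

theorem avg_add {w : α → ℝ} (f g : α → ℝ) :
    avg w (fun a => f a + g a) = avg w f + avg w g := by
  simp only [avg, mul_add, sum_add_distrib]

theorem avg_const_mul {w : α → ℝ} (r : ℝ) (f : α → ℝ) :
    avg w (fun a => r * f a) = r * avg w f := by
  simp only [avg, mul_sum]
  exact sum_congr rfl fun a _ => by ring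

theorem avg_comm (w : α → ℝ) (v : β → ℝ) (f : α → β → ℝ) :
    avg w (fun a => avg v (f a)) = avg v fun b => avg w fun a => f a b := by
  simp only [avg, mul_sum]
  rw [sum_comm]
  exact sum_congr rfl fun a _ => sum_congr rfl fun b _ => by ring

theorem prob_nonneg {w : α → ℝ} (hw : w ∈ stdSimplex ℝ α) (E : α → Prop) : 0 ≤ prob w E :=
  avg_nonneg hw fun a => by split_ifs <;> norm_num

theorem prob_le_one {w : α → ℝ} (hw : w ∈ stdSimplex ℝ α) (E : α → Prop) : prob w E ≤ 1 :=
  avg_le_const hw fun a => by split_ifs <;> norm_num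

theorem prob_mono {w : α → ℝ} (hw : w ∈ stdSimplex ℝ α) {E F : α → Prop}
    (h : ∀ a, E a → F a) : prob w E ≤ prob w F :=
  avg_mono hw fun a => by
    by_cases hE : E a
    · simp [hE, h a hE]
    · simp only [hE, if_false]; split_ifs <;> norm_num

theorem prob_or_le {w : α → ℝ} (hw : w ∈ stdSimplex ℝ α) (E F : α → Prop) :
    prob w (fun a => E a ∨ F a) ≤ prob w E + prob w F := by
  rw [prob, prob, prob, ← avg_add]
  refine avg_mono hw fun a => ?_
  by_cases hE : E a <;> by_cases hF : F a <;> simp [hE, hF]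

omit [Fintype β] in
theorem prob_exists_le {w : α → ℝ} (hw : w ∈ stdSimplex ℝ α) (s : Finset β)
    (E : β → α → Prop) :
    prob w (fun a => ∃ b ∈ s, E b a) ≤ ∑ b ∈ s, prob w (E b) := by
  simp only [prob]
  rw [← avg_sum]
  refine avg_mono hw fun a => ?_
  have hn : ∀ b ∈ s, (0 : ℝ) ≤ if E b a then 1 else 0 := fun b _ => by split_ifs <;> norm_num
  split_ifs with h
  · obtain ⟨b, hb, hE⟩ := h
    refine le_trans ?_ (single_le_sum hn hb)
    simp [hE]
  · exact sum_nonneg hn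

theorem exists_of_prob_lt_one {w : α → ℝ} (hw : w ∈ stdSimplex ℝ α) {E : α → Prop}
    (h : prob w E < 1) : ∃ a, w a ≠ 0 ∧ ¬ E a := by
  by_contra! hne
  refine h.ne ?_
  rw [← hw.2]
  refine sum_congr rfl fun a _ => ?_
  by_cases ha : w a = 0
  · simp [ha]
  · simp [hne a ha]

theorem piW_mem {w : ι → α → ℝ} (hw : ∀ i, w i ∈ stdSimplex ℝ α) :
    piW w ∈ stdSimplex ℝ (ι → α) := by
  refine ⟨fun c => prod_nonneg fun i _ => (hw i).1 _, ?_⟩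
  have := (prod_univ_sum (fun _ : ι => (univ : Finset α)) w).symm
  rw [Fintype.piFinset_univ] at this
  simp only [piW, this, (hw _).2, prod_const_one]

theorem avg_piW_prod (w f : ι → α → ℝ) :
    avg (piW w) (fun c => ∏ i, f i (c i)) = ∏ i, avg (w i) (f i) := by
  have := prod_univ_sum (fun _ : ι => (univ : Finset α)) fun i a => w i a * f i a
  rw [Fintype.piFinset_univ] at this
  simp only [avg, this, piW, prod_mul_distrib]

/-- Redrawing one coordinate of a product law. -/
theorem avg_piW_update {w : ι → α → ℝ} (i : ι) (hw : w i ∈ stdSimplex ℝ α)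
    (f : (ι → α) → ℝ) :
    avg (piW w) f = avg (piW w) fun c => avg (w i) fun a => f (Function.update c i a) := by
  -- Exchanging the old coordinate with the fresh one is an involution that preserves the joint
  -- weight.
  set σ : (ι → α) × α → (ι → α) × α := fun q => (Function.update q.1 i q.2, q.1 i) with hσ
  have hinv : Function.Involutive σ := fun q => by simp [hσ]
  have hwt : ∀ q : (ι → α) × α, piW w q.1 * w i q.2 = piW w (σ q).1 * w i (σ q).2 := by
    intro q
    simp only [piW, hσ]
    rw [← mul_prod_erase univ _ (mem_univ i), ← mul_prod_erase univ (fun j => w j _) (mem_univ i)]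
    have : ∏ j ∈ univ.erase i, w j (Function.update q.1 i q.2 j)
        = ∏ j ∈ univ.erase i, w j (q.1 j) :=
      prod_congr rfl fun j hj => by rw [Function.update_of_ne (ne_of_mem_erase hj)]
    rw [this, Function.update_self]
    ring
  have h1 : avg (piW w) f = ∑ q : (ι → α) × α, piW w q.1 * w i q.2 * f q.1 := by
    rw [Fintype.sum_prod_type]
    refine sum_congr rfl fun c _ => ?_
    dsimp only
    rw [← sum_mul, ← mul_sum, hw.2, mul_one]
  have h2 : avg (piW w) (fun c => avg (w i) fun a => f (Function.update c i a))
      = ∑ q : (ι → α) × α, piW w q.1 * w i q.2 * f (σ q).1 := by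
    rw [Fintype.sum_prod_type]
    refine sum_congr rfl fun c _ => ?_
    simp only [avg, mul_sum]
    exact sum_congr rfl fun a _ => by simp only [hσ]; ring
  rw [h1, h2, ← Equiv.sum_comp hinv.toPerm]
  exact sum_congr rfl fun q _ => by rw [hwt q]; rfl

theorem avg_piW_apply {w : ι → α → ℝ} (hw : ∀ i, w i ∈ stdSimplex ℝ α) (i : ι) (f : α → ℝ) :
    avg (piW w) (fun c => f (c i)) = avg (w i) f := by
  rw [avg_piW_update i (hw i)]
  simp only [Function.update_self]
  exact avg_const (piW_mem hw) _

/-- Iterated expectation over two product laws, the second depending on the first, is the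
expectation over the product of the pair laws. -/
theorem avg_piW_pair (w : ι → α → ℝ) (v : ι → α → β → ℝ) (f : (ι → α) → (ι → β) → ℝ) :
    avg (piW w) (fun a => avg (piW fun i => v i (a i)) (f a))
      = avg (piW fun i (q : α × β) => w i q.1 * v i q.1 q.2)
        (fun c => f (fun i => (c i).1) fun i => (c i).2) := by
  simp only [avg, piW, mul_sum]
  rw [← Fintype.sum_prod_type' (f := fun (a : ι → α) (b : ι → β) =>
    (∏ i, w i (a i)) * ((∏ i, v i (a i) (b i)) * f a b)),
    ← Equiv.sum_comp (Equiv.arrowProdEquivProdArrow ι (fun _ => α) (fun _ => β))]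
  refine sum_congr rfl fun c _ => ?_
  simp [Equiv.arrowProdEquivProdArrow, prod_mul_distrib, mul_assoc]

theorem prob_piW_pair (w : ι → α → ℝ) (v : ι → α → β → ℝ) (E : (ι → α) → (ι → β) → Prop) :
    avg (piW w) (fun a => prob (piW fun i => v i (a i)) (E a))
      = prob (piW fun i (q : α × β) => w i q.1 * v i q.1 q.2)
        (fun c => E (fun i => (c i).1) fun i => (c i).2) :=
  avg_piW_pair w v _

theorem prob_le_avg_exp {w : α → ℝ} (hw : w ∈ stdSimplex ℝ α) (g : α → ℝ) (t : ℝ) :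
    prob w (fun a => t ≤ g a) ≤ avg w (fun a => Real.exp (g a)) * Real.exp (-t) := by
  rw [mul_comm, ← avg_const_mul]
  refine avg_mono hw fun a => ?_
  rw [← Real.exp_add]
  split_ifs with h
  · exact Real.one_le_exp (by linarith)
  · positivity

/-- A Chernoff bound with parameter 1. On [0,1] one has exp x ≤ 1 + 2x, which is the source of the
factor 2 in front of the mean. It serves when the threshold is a constant multiple of the mean, or
far above it. -/
theorem prob_sum_ge_le {w g : ι → α → ℝ} (hw : ∀ i, w i ∈ stdSimplex ℝ α)
    (h0 : ∀ i a, 0 ≤ g i a) (h1 : ∀ i a, g i a ≤ 1) (t : ℝ) :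
    prob (piW w) (fun c => t ≤ ∑ i, g i (c i))
      ≤ Real.exp (2 * ∑ i, avg (w i) (g i) - t) := by
  refine (prob_le_avg_exp (piW_mem hw) _ t).trans ?_
  rw [sub_eq_add_neg, Real.exp_add]
  refine mul_le_mul_of_nonneg_right ?_ (Real.exp_pos _).le
  simp only [Real.exp_sum, mul_sum]
  rw [avg_piW_prod w fun i a => Real.exp (g i a)]
  refine prod_le_prod (fun i _ => avg_nonneg (hw i) fun a => (Real.exp_pos _).le) fun i _ => ?_
  have hb : ∀ a, Real.exp (g i a) ≤ 1 + 2 * g i a := fun a => by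
    have := abs_le.1 (Real.abs_exp_sub_one_sub_id_le (x := g i a)
      (abs_le.2 ⟨by linarith [h0 i a], h1 i a⟩))
    nlinarith [h0 i a, h1 i a]
  calc avg (w i) (fun a => Real.exp (g i a)) ≤ avg (w i) (fun a => 1 + 2 * g i a) :=
        avg_mono (hw i) hb
    _ = 2 * avg (w i) (g i) + 1 := by
        rw [avg_add, avg_const (hw i), avg_const_mul, add_comm]
    _ ≤ _ := Real.add_one_le_exp _

/-- A choice that keeps finitely many sums of independent `[0,1]`-valued variables below a
threshold. -/
theorem exists_forall_sum_lt {σ : Type*} [Fintype σ] {w : ι → α → ℝ} {g : σ → ι → α → ℝ}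
    (hw : ∀ i, w i ∈ stdSimplex ℝ α) (h0 : ∀ s i a, 0 ≤ g s i a) (h1 : ∀ s i a, g s i a ≤ 1)
    {μ t : ℝ} (hμ : ∀ s, ∑ i, avg (w i) (g s i) ≤ μ)
    (ht : Fintype.card σ * Real.exp (2 * μ - t) < 1) :
    ∃ c : ι → α, (∀ i, w i (c i) ≠ 0) ∧ ∀ s, ∑ i, g s i (c i) < t := by
  have hp : prob (piW w) (fun c => ∃ s ∈ (univ : Finset σ), t ≤ ∑ i, g s i (c i)) < 1 := by
    refine (prob_exists_le (piW_mem hw) univ _).trans_lt (lt_of_le_of_lt ?_ ht)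
    rw [← nsmul_eq_mul, ← card_univ]
    refine sum_le_card_nsmul _ _ _ fun s _ => (prob_sum_ge_le hw (h0 s) (h1 s) t).trans ?_
    exact Real.exp_le_exp.2 (by linarith [hμ s])
  obtain ⟨c, hc, hE⟩ := exists_of_prob_lt_one (piW_mem hw) hp
  push Not at hE
  exact ⟨c, fun i => prod_ne_zero_iff.1 hc i (mem_univ i), fun s => hE s (mem_univ s)⟩

/-- The exponential moment at parameter s is at most exp(s²) per coordinate for s ≤ 1, and s²−sη is
minimal at s = η/2; the hypothesis η ≤ 2 keeps s in range. -/
theorem prob_sum_ge_le_of_avg_eq_zero {w h : ι → α → ℝ} (hw : ∀ i, w i ∈ stdSimplex ℝ α)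
    (hb : ∀ i a, |h i a| ≤ 1) (hm : ∀ i, avg (w i) (h i) = 0) {η : ℝ} (h0 : 0 ≤ η) (h1 : η ≤ 2) :
    prob (piW w) (fun c => Fintype.card ι * η ≤ ∑ i, h i (c i))
      ≤ Real.exp (-(Fintype.card ι * (η ^ 2 / 4))) := by
  set n : ℝ := (Fintype.card ι : ℝ)
  have hE : prob (piW w) (fun c => n * η ≤ ∑ i, h i (c i))
      ≤ prob (piW w) (fun c => η / 2 * (n * η) ≤ ∑ i, η / 2 * h i (c i)) :=
    prob_mono (piW_mem hw) fun c hc => by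
      rw [← mul_sum]; exact mul_le_mul_of_nonneg_left hc (by linarith)
  refine hE.trans ((prob_le_avg_exp (piW_mem hw) _ _).trans ?_)
  have key : avg (piW w) (fun c => Real.exp (∑ i, η / 2 * h i (c i)))
      ≤ Real.exp (n * (η ^ 2 / 4)) := by
    simp only [Real.exp_sum]
    rw [avg_piW_prod w fun i a => Real.exp (η / 2 * h i a)]
    have : Real.exp (n * (η ^ 2 / 4)) = ∏ _i : ι, Real.exp (η ^ 2 / 4) := by
      rw [prod_const, card_univ, ← Real.exp_nat_mul]
    rw [this]
    refine prod_le_prod (fun i _ => avg_nonneg (hw i) fun a => (Real.exp_pos _).le) fun i _ => ?_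
    have hb' : ∀ a, Real.exp (η / 2 * h i a) ≤ (1 + η ^ 2 / 4) + η / 2 * h i a := fun a => by
      have ha := abs_le.1 (hb i a)
      have hx : |η / 2 * h i a| ≤ 1 := by
        rw [abs_mul, abs_of_nonneg (by linarith : (0 : ℝ) ≤ η / 2)]
        nlinarith [hb i a, abs_nonneg (h i a)]
      have := abs_le.1 (Real.abs_exp_sub_one_sub_id_le hx)
      have hs : (h i a) ^ 2 ≤ 1 := by nlinarith
      nlinarith [sq_nonneg η, mul_le_mul_of_nonneg_left hs (sq_nonneg η)]
    calc avg (w i) (fun a => Real.exp (η / 2 * h i a))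
        ≤ avg (w i) (fun a => (1 + η ^ 2 / 4) + η / 2 * h i a) := avg_mono (hw i) hb'
      _ = η ^ 2 / 4 + 1 := by
        rw [avg_add, avg_const (hw i), avg_const_mul, hm i]; ring
      _ ≤ _ := Real.add_one_le_exp _
  calc _ ≤ Real.exp (n * (η ^ 2 / 4)) * Real.exp (-(η / 2 * (n * η))) :=
        mul_le_mul_of_nonneg_right key (Real.exp_pos _).le
    _ = _ := by rw [← Real.exp_add]; congr 1; ring

end FiniteProbability

/-! ### Empirical distributions and typical sequences -/

section Empirical

variable {A B S : Type*} {n : ℕ}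

/-- The empirical distribution of a sequence. -/
def emp (ω : Fin n → A) (a : A) : ℝ := (∑ t, if ω t = a then (1 : ℝ) else 0) / n

theorem emp_nonneg (ω : Fin n → A) (a : A) : 0 ≤ emp ω a :=
  div_nonneg (sum_nonneg fun t _ => by split_ifs <;> norm_num) (Nat.cast_nonneg n)

theorem emp_mem [Fintype A] (hn : n ≠ 0) (ω : Fin n → A) : emp ω ∈ stdSimplex ℝ A := by
  refine ⟨emp_nonneg ω, ?_⟩
  simp only [emp]
  rw [← sum_div, sum_comm]
  simp [hn]

theorem law_emp [Fintype A] (ω : Fin n → A) (f : A → B) :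
    law (emp ω) f = emp fun t => f (ω t) := by
  funext b
  simp only [law, emp]
  rw [← sum_filter, ← sum_div, sum_comm]
  congr 1
  refine sum_congr rfl fun t _ => ?_
  rw [sum_ite_eq]
  simp

/-- The pair sequence `(s, v)` is `η`-typical for the channel `w`. -/
def Typical (w : S → A → ℝ) (η : ℝ) (s : Fin n → S) (v : Fin n → A) : Prop :=
  ∀ σ a, |emp (fun t => (s t, v t)) (σ, a) - emp s σ * w σ a| ≤ η

theorem prob_not_typical_le [Fintype A] [Fintype S] {w : S → A → ℝ}
    (hw : ∀ σ, w σ ∈ stdSimplex ℝ A) {η : ℝ} (h0 : 0 ≤ η) (h1 : η ≤ 2) (s : Fin n → S)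
    (hn : n ≠ 0) :
    prob (piW fun t => w (s t)) (fun v => ¬ Typical w η s v)
      ≤ 2 * (Fintype.card S * Fintype.card A) * Real.exp (-(n * (η ^ 2 / 4))) := by
  have hW := piW_mem fun t => hw (s t)
  have hn' : (0 : ℝ) < n := by positivity
  -- Centred indicators of the pair q; the sign turns a two-sided deviation into two one-sided ones.
  set h : Bool → S × A → Fin n → A → ℝ := fun e q t v =>
    (if e then 1 else -1) * if s t = q.1 then (if v = q.2 then 1 else 0) - w q.1 q.2 else 0 with hh
  have hw1 : ∀ σ a, w σ a ≤ 1 := fun σ a =>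
    (hw σ).2 ▸ single_le_sum (f := w σ) (fun b _ => (hw σ).1 b) (mem_univ a)
  have hb : ∀ e q t v, |h e q t v| ≤ 1 := by
    intro e q t v
    have hx : |(if s t = q.1 then (if v = q.2 then (1 : ℝ) else 0) - w q.1 q.2 else 0)| ≤ 1 := by
      have := hw1 q.1 q.2
      have := (hw q.1).1 q.2
      split_ifs <;> rw [abs_le] <;> constructor <;> linarith
    simp only [hh, abs_mul]
    cases e <;> simpa using hx
  have hm : ∀ e q t, avg (w (s t)) (h e q t) = 0 := by
    intro e q t
    simp only [hh]
    rw [avg_const_mul]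
    by_cases hs : s t = q.1
    · have : avg (w (s t)) (fun v => (if v = q.2 then (1 : ℝ) else 0) - w q.1 q.2) = 0 := by
        simp only [sub_eq_add_neg]
        rw [avg_add, avg_const (hw _)]
        simp [avg, hs]
      rw [hs] at this
      simp only [hs, if_true, this, mul_zero]
    · simp [hs, avg]
  have hsum : ∀ q (v : Fin n → A), ∑ t, h true q t (v t)
      = n * (emp (fun t => (s t, v t)) q - emp s q.1 * w q.1 q.2) := by
    intro q v
    simp only [hh, emp, if_true, one_mul]
    field_simp
    rw [mul_sum, ← sum_sub_distrib]
    refine sum_congr rfl fun t _ => ?_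
    by_cases h1 : s t = q.1 <;> by_cases h2 : v t = q.2 <;> simp [h1, h2, Prod.ext_iff]
  have hneg : ∀ q (v : Fin n → A), ∑ t, h false q t (v t) = - ∑ t, h true q t (v t) := by
    intro q v
    rw [← sum_neg_distrib]
    exact sum_congr rfl fun t _ => by simp only [hh, if_true, one_mul, Bool.false_eq_true, if_false, neg_mul]
  have hsub : ∀ v, ¬ Typical w η s v →
      ∃ eq ∈ (univ : Finset (Bool × (S × A))), (n : ℝ) * η ≤ ∑ t, h eq.1 eq.2 t (v t) := by
    intro v hv
    simp only [Typical, not_forall, not_le] at hv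
    obtain ⟨σ, a, hσ⟩ := hv
    rcases lt_abs.1 hσ with hp | hp
    · exact ⟨(true, σ, a), mem_univ _, by rw [hsum]; exact mul_le_mul_of_nonneg_left hp.le hn'.le⟩
    · refine ⟨(false, σ, a), mem_univ _, ?_⟩
      rw [hneg, hsum, ← mul_neg]
      exact mul_le_mul_of_nonneg_left hp.le hn'.le
  refine (prob_mono hW hsub).trans ((prob_exists_le hW _ _).trans ?_)
  refine (sum_le_card_nsmul _ _ (Real.exp (-(n * (η ^ 2 / 4)))) fun eq _ => ?_).trans ?_
  · simpa using prob_sum_ge_le_of_avg_eq_zero (fun t => hw (s t)) (hb eq.1 eq.2) (hm eq.1 eq.2) h0 h1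
  · rw [nsmul_eq_mul]; simp

end Empirical

/-! ### Laws of random variables and continuity of mutual information -/

section Law

variable {Ω A B C : Type*} [Fintype Ω]

theorem law_nonneg {p : Ω → ℝ} (hp : ∀ ω, 0 ≤ p ω) (f : Ω → A) (a : A) : 0 ≤ law p f a :=
  sum_nonneg fun ω _ => by split_ifs <;> simp [hp]

theorem sum_law [Fintype A] (p : Ω → ℝ) (f : Ω → A) : ∑ a, law p f a = ∑ ω, p ω := by
  simp only [law]
  rw [sum_comm]
  simp

theorem law_mem [Fintype A] {p : Ω → ℝ} (hp : p ∈ stdSimplex ℝ Ω) (f : Ω → A) :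
    law p f ∈ stdSimplex ℝ A :=
  ⟨law_nonneg hp.1 f, (sum_law p f).trans hp.2⟩

theorem sum_law_fst [Fintype A] (p : Ω → ℝ) (f : Ω → A) (g : Ω → B) (b : B) :
    ∑ a, law p (fun ω => (f ω, g ω)) (a, b) = law p g b := by
  simp only [law, Prod.ext_iff]
  rw [sum_comm]
  refine sum_congr rfl fun ω _ => ?_
  by_cases h : g ω = b <;> simp [h]

theorem sum_law_snd [Fintype B] (p : Ω → ℝ) (f : Ω → A) (g : Ω → B) (a : A) :
    ∑ b, law p (fun ω => (f ω, g ω)) (a, b) = law p f a := by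
  simp only [law, Prod.ext_iff]
  rw [sum_comm]
  refine sum_congr rfl fun ω _ => ?_
  by_cases h : f ω = a <;> simp [h]

theorem law_comp_injective (p : Ω → ℝ) (f : Ω → A) {e : A → B} (he : Function.Injective e)
    (a : A) : law p (fun ω => e (f ω)) (e a) = law p f a := by
  simp [law, he.eq_iff]

theorem law_le_law {p : Ω → ℝ} (hp : ∀ ω, 0 ≤ p ω) {f : Ω → A} {g : Ω → B} {a : A} {b : B}
    (h : ∀ ω, f ω = a → g ω = b) : law p f a ≤ law p g b :=
  sum_le_sum fun ω _ => by
    by_cases hf : f ω = a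
    · simp [hf, h ω hf]
    · simp only [hf, if_false]; split_ifs <;> simp [hp]

theorem continuous_law (f : Ω → A) (a : A) : Continuous fun p : Ω → ℝ => law p f a := by
  refine continuous_finsetSum _ fun ω _ => ?_
  split_ifs <;> fun_prop

/-- In this form continuity is visible even where probabilities vanish, because x log x is
continuous. -/
theorem mutualInfo_eq_entropies [Fintype A] [Fintype B] {p : Ω → ℝ} (hp : ∀ ω, 0 ≤ p ω)
    (f : Ω → A) (g : Ω → B) :
    mutualInfo p f g
      = ((∑ a, ∑ b, law p (fun ω => (f ω, g ω)) (a, b) *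
            Real.log (law p (fun ω => (f ω, g ω)) (a, b)))
          - (∑ a, law p f a * Real.log (law p f a))
          - ∑ b, law p g b * Real.log (law p g b)) / Real.log 2 := by
  have h1 : ∑ a, law p f a * Real.log (law p f a)
      = ∑ a, ∑ b, law p (fun ω => (f ω, g ω)) (a, b) * Real.log (law p f a) :=
    sum_congr rfl fun a _ => by rw [← sum_mul, sum_law_snd]
  have h2 : ∑ b, law p g b * Real.log (law p g b)
      = ∑ a, ∑ b, law p (fun ω => (f ω, g ω)) (a, b) * Real.log (law p g b) := by
    rw [sum_comm]
    exact sum_congr rfl fun b _ => by rw [← sum_mul, sum_law_fst]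
  rw [h1, h2, ← sum_sub_distrib, ← sum_sub_distrib, sum_div, mutualInfo]
  refine sum_congr rfl fun a _ => ?_
  rw [← sum_sub_distrib, ← sum_sub_distrib, sum_div]
  refine sum_congr rfl fun b _ => ?_
  rcases (law_nonneg hp (fun ω => (f ω, g ω)) (a, b)).eq_or_lt with h0 | h0
  · simp [← h0]
  · have ha : 0 < law p f a := h0.trans_le (law_le_law hp fun ω h => congrArg Prod.fst h)
    have hb : 0 < law p g b := h0.trans_le (law_le_law hp fun ω h => congrArg Prod.snd h)
    rw [Real.logb, Real.log_div h0.ne' (mul_pos ha hb).ne', Real.log_mul ha.ne' hb.ne']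
    ring

theorem continuousOn_mutualInfo [Fintype A] [Fintype B] (f : Ω → A) (g : Ω → B) :
    ContinuousOn (fun p => mutualInfo p f g) (stdSimplex ℝ Ω) := by
  refine ContinuousOn.congr ?_ fun p hp => mutualInfo_eq_entropies hp.1 f g
  refine Continuous.continuousOn ((Continuous.sub (Continuous.sub ?_ ?_) ?_).div_const _)
  · exact continuous_finsetSum _ fun a _ => continuous_finsetSum _ fun b _ =>
      Real.continuous_mul_log.comp (continuous_law _ _)
  · exact continuous_finsetSum _ fun a _ => Real.continuous_mul_log.comp (continuous_law _ _)
  · exact continuous_finsetSum _ fun a _ => Real.continuous_mul_log.comp (continuous_law _ _)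

/-- The chain rule with I(f;h) = 0. It replaces conditional information by information about the
pair, so that one estimate for unconditional empirical information covers both rates. -/
theorem condMutualInfo_eq_mutualInfo [Fintype A] [Fintype B] [Fintype C] {p : Ω → ℝ}
    (hp : ∀ ω, 0 ≤ p ω) {f : Ω → A} {g : Ω → B} {h : Ω → C} (hi : IndepVars p h f) :
    condMutualInfo p f g h = mutualInfo p f fun ω => (h ω, g ω) := by
  simp only [condMutualInfo, mutualInfo]
  refine sum_congr rfl fun a _ => ?_
  rw [Fintype.sum_prod_type, sum_comm]
  refine sum_congr rfl fun c _ => sum_congr rfl fun b _ => ?_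
  have e1 : law p (fun ω => (f ω, g ω, h ω)) (a, b, c)
      = law p (fun ω => (f ω, h ω, g ω)) (a, c, b) :=
    (law_comp_injective p (fun ω => (f ω, g ω, h ω)) (e := fun q => (q.1, q.2.2, q.2.1))
      (fun q r => by simp +contextual [Prod.ext_iff]) (a, b, c)).symm
  have e2 : law p (fun ω => (g ω, h ω)) (b, c) = law p (fun ω => (h ω, g ω)) (c, b) :=
    (law_comp_injective p (fun ω => (g ω, h ω)) Prod.swap_injective (b, c)).symm
  have e3 : law p (fun ω => (f ω, h ω)) (a, c) = law p h c * law p f a := by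
    rw [← hi]
    exact (law_comp_injective p (fun ω => (f ω, h ω)) Prod.swap_injective (a, c)).symm
  rw [e1, e2, e3]
  rcases (law_nonneg hp (fun ω => (f ω, h ω, g ω)) (a, c, b)).eq_or_lt with h0 | h0
  · simp [← h0]
  · have hc : 0 < law p h c :=
      h0.trans_le (law_le_law hp fun ω hω => congrArg (fun q => q.2.1) hω)
    rw [mul_comm _ (law p h c), mul_assoc, mul_div_mul_left _ _ hc.ne']

end Law

/-! ### Empirical mutual information and the method of types -/

section EmpiricalInformation

variable {A B C : Type*} {n : ℕ}

theorem emp_comp_injective (ω : Fin n → A) {e : A → B} (he : Function.Injective e) (a : A) :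
    emp (fun t => e (ω t)) (e a) = emp ω a := by
  simp [emp, he.eq_iff]

theorem sum_emp_mul [Fintype A] (ω : Fin n → A) (F : A → ℝ) :
    ∑ a, emp ω a * F a = (∑ t, F (ω t)) / n := by
  simp only [emp, div_mul_eq_mul_div, sum_mul]
  rw [← sum_div, sum_comm]
  simp

theorem emp_pos (ω : Fin n → A) (t : Fin n) : 0 < emp ω (ω t) := by
  refine div_pos ?_ (by exact_mod_cast t.pos)
  refine lt_of_lt_of_le ?_ (single_le_sum (fun s _ => ?_) (mem_univ t))
  · simp
  · split_ifs <;> norm_num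

/-- The empirical mutual information of two sequences. -/
def empInfo [Fintype A] [Fintype B] (u : Fin n → A) (v : Fin n → B) : ℝ :=
  mutualInfo (emp fun t => (u t, v t)) Prod.fst Prod.snd

theorem mutualInfo_emp [Fintype C] [Fintype A] [Fintype B] (ω : Fin n → C) (f : C → A)
    (g : C → B) :
    mutualInfo (emp ω) f g = empInfo (fun t => f (ω t)) fun t => g (ω t) := by
  simp only [empInfo, mutualInfo, law_emp]

/-- Gibbs' inequality: by x ≤ exp(x−1), the product of the ratios P/emp is at most exp(Σ(P/emp −
1)), and the sum over t of the ratios is n times the P-mass of the symbols that occur, hence at most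
n. -/
theorem prod_le_prod_emp [Fintype A] {P : A → ℝ} (hP : P ∈ stdSimplex ℝ A) (u : Fin n → A) :
    ∏ t, P (u t) ≤ ∏ t, emp u (u t) := by
  have hle : ∏ t, P (u t) / emp u (u t) ≤ 1 := by
    calc ∏ t, P (u t) / emp u (u t) ≤ ∏ t, Real.exp (P (u t) / emp u (u t) - 1) :=
          prod_le_prod (fun t _ => div_nonneg (hP.1 _) (emp_nonneg _ _)) fun t _ => by
            linarith [Real.add_one_le_exp (P (u t) / emp u (u t) - 1)]
      _ = Real.exp (∑ t, (P (u t) / emp u (u t) - 1)) := (Real.exp_sum _ _).symm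
      _ ≤ 1 := by
          rw [Real.exp_le_one_iff]
          rcases Nat.eq_zero_or_pos n with rfl | hn
          · simp
          have hn' : (0 : ℝ) < n := by exact_mod_cast hn
          have h1 := sum_emp_mul u fun a => P a / emp u a
          have h2 : ∑ a, emp u a * (P a / emp u a) ≤ 1 := by
            rw [← hP.2]
            refine sum_le_sum fun a _ => ?_
            by_cases ha : emp u a = 0
            · simp [ha, hP.1 a]
            · rw [mul_div_cancel₀ _ ha]
          rw [h1, div_le_one hn'] at h2
          simp only [sum_sub_distrib, sum_const, card_univ, Fintype.card_fin, nsmul_eq_mul,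
            mul_one]
          linarith
  rw [prod_div_distrib, div_le_one (prod_pos fun t _ => emp_pos u t)] at hle
  exact hle

/-- After P is replaced by the type of u, the inequality becomes an identity: 2^(n I) is the product
of the ratios of the joint type to the product of its marginals. -/
theorem prod_le_rpow_empInfo_mul [Fintype A] [Fintype B] {P : A → ℝ} (hP : P ∈ stdSimplex ℝ A)
    (hn : n ≠ 0) (u : Fin n → A) (v : Fin n → B) :
    ∏ t, P (u t) ≤ (2 : ℝ) ^ (-(n * empInfo u v)) *
      ∏ t, emp (fun t => (u t, v t)) (u t, v t) / emp v (v t) := by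
  have hn' : (n : ℝ) ≠ 0 := by exact_mod_cast hn
  have hT : ∀ t, 0 < emp (fun t => (u t, v t)) (u t, v t) := emp_pos fun t => (u t, v t)
  have hI : n * empInfo u v = ∑ t, Real.logb 2
      (emp (fun t => (u t, v t)) (u t, v t) / (emp u (u t) * emp v (v t))) := by
    have := sum_emp_mul (fun t => (u t, v t)) fun q : A × B => Real.logb 2
      (emp (fun t => (u t, v t)) q / (emp u q.1 * emp v q.2))
    rw [Fintype.sum_prod_type] at this
    simp only [empInfo, mutualInfo, law_emp]
    rw [this]
    field_simp
  have hpow : (2 : ℝ) ^ (n * empInfo u v)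
      = ∏ t, emp (fun t => (u t, v t)) (u t, v t) / (emp u (u t) * emp v (v t)) := by
    rw [hI, Real.rpow_sum_of_pos two_pos]
    refine prod_congr rfl fun t _ => ?_
    exact Real.rpow_logb two_pos (by norm_num)
      (div_pos (hT t) (mul_pos (emp_pos u t) (emp_pos v t)))
  refine (prod_le_prod_emp hP u).trans (le_of_eq ?_)
  rw [Real.rpow_neg two_pos.le, hpow, ← prod_inv_distrib, ← prod_mul_distrib]
  refine prod_congr rfl fun t _ => ?_
  have := (hT t).ne'
  have := (emp_pos u t).ne'
  have := (emp_pos v t).ne'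
  field_simp

/-- The probability that a memoryless sequence has large empirical mutual information with a
fixed sequence. -/
theorem prob_empInfo_ge_le [Fintype A] [Fintype B] {P : A → ℝ} (hP : P ∈ stdSimplex ℝ A)
    (hn : n ≠ 0) (v : Fin n → B) (θ : ℝ) :
    prob (piW fun _ => P) (fun u : Fin n → A => θ ≤ empInfo u v)
      ≤ ((n : ℝ) + 1) ^ (Fintype.card A * Fintype.card B) * (2 : ℝ) ^ (-(n * θ)) := by
  have hn' : (0 : ℝ) < n := by positivity
  -- Each table k of counts defines a conditional distribution. Columns without counts give 0 by the
  -- convention for division, so the total mass is only bounded by 1, which suffices.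
  set V : (A × B → Fin (n + 1)) → B → A → ℝ := fun k b a =>
    (k (a, b) : ℝ) / ∑ a', (k (a', b) : ℝ) with hV
  have hV0 : ∀ k b a, 0 ≤ V k b a := fun k b a => by positivity
  have hV1 : ∀ k b, ∑ a, V k b a ≤ 1 := fun k b => by
    simp only [hV]; rw [← sum_div]; exact div_self_le_one _
  have hpt : ∀ u : Fin n → A, piW (fun _ => P) u * (if θ ≤ empInfo u v then 1 else 0)
      ≤ (2 : ℝ) ^ (-(n * θ)) * ∑ k, ∏ t, V k (v t) (u t) := by
    intro u
    have hs : 0 ≤ ∑ k, ∏ t, V k (v t) (u t) :=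
      sum_nonneg fun k _ => prod_nonneg fun t _ => hV0 _ _ _
    split_ifs with h
    · rw [mul_one]
      refine (prod_le_rpow_empInfo_mul hP hn u v).trans ?_
      refine mul_le_mul ?_ ?_ (prod_nonneg fun t _ =>
        div_nonneg (emp_nonneg _ _) (emp_nonneg _ _)) (by positivity)
      · exact Real.rpow_le_rpow_of_exponent_le one_le_two (by nlinarith)
      -- The table of joint counts of (u, v) makes V the empirical conditional distribution of u
      -- given v. Summing over all tables removes the dependence on u at the price of a polynomial
      -- factor.
      · let k : A × B → Fin (n + 1) := fun q =>
          ⟨#{t | (u t, v t) = q}, Nat.lt_succ_of_le (by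
            simpa using card_le_univ (univ.filter fun t => (u t, v t) = q))⟩
        have hk : ∀ q, (k q : ℝ) = n * emp (fun t => (u t, v t)) q := fun q => by
          rw [emp, mul_div_cancel₀ _ hn'.ne']
          simp only [k]
          rw [natCast_card_filter]
          exact sum_congr rfl fun t _ => by congr
        refine le_trans (le_of_eq ?_) (single_le_sum
          (f := fun k => ∏ t, V k (v t) (u t))
          (fun k _ => prod_nonneg fun t _ => hV0 _ _ _) (mem_univ k))
        refine prod_congr rfl fun t _ => ?_
        have hm : ∑ a, emp (fun t => (u t, v t)) (a, v t) = emp v (v t) := by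
          have := sum_law_fst (emp fun t => (u t, v t)) Prod.fst Prod.snd (v t)
          simpa only [law_emp] using this
        simp only [hV, hk]
        rw [← mul_sum, hm, mul_div_mul_left _ _ hn'.ne']
    · rw [mul_zero]; positivity
  refine (sum_le_sum fun u _ => hpt u).trans ?_
  rw [← mul_sum, mul_comm, sum_comm]
  refine mul_le_mul_of_nonneg_right ?_ (by positivity)
  have hone : ∀ k ∈ univ, ∑ u : Fin n → A, ∏ t, V k (v t) (u t) ≤ 1 := fun k _ => by
    have := prod_univ_sum (fun _ : Fin n => (univ : Finset A)) fun t a => V k (v t) a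
    rw [Fintype.piFinset_univ] at this
    rw [← this]
    exact prod_le_one (fun t _ => sum_nonneg fun a _ => hV0 _ _ _) fun t _ => hV1 _ _
  refine (sum_le_card_nsmul _ _ 1 hone).trans (le_of_eq ?_)
  simp

end EmpiricalInformation

/-! ### From rate bounds on the attack set to bounds for sequences -/

/-- On a compact set, a lower bound valid on the common zero set of finitely many continuous
functions is almost valid near that zero set. -/
theorem IsCompact.exists_le_of_abs_le {E ι : Type*} [TopologicalSpace E] [T2Space E] [Fintype ι]
    {K : Set E} (hK : IsCompact K) {d : ι → E → ℝ} (hd : ∀ i, Continuous (d i)) {g : E → ℝ}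
    (hg : ContinuousOn g K) {R : ℝ} (h : ∀ p ∈ K, (∀ i, d i p = 0) → R ≤ g p) {ξ : ℝ}
    (hξ : 0 < ξ) :
    ∃ η > 0, ∀ p ∈ K, (∀ i, |d i p| ≤ η) → R - ξ ≤ g p := by
  have hc : IsCompact (K ∩ g ⁻¹' Set.Iic (R - ξ)) :=
    hK.of_isClosed_subset (hg.preimage_isClosed_of_isClosed hK.isClosed isClosed_Iic)
      Set.inter_subset_left
  rcases (K ∩ g ⁻¹' Set.Iic (R - ξ)).eq_empty_or_nonempty with he | hne
  · refine ⟨1, one_pos, fun p hp _ => ?_⟩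
    by_contra! hlt
    exact (he ▸ (⟨hp, hlt.le⟩ : p ∈ K ∩ g ⁻¹' Set.Iic (R - ξ)) : p ∈ (∅ : Set E))
  -- The total violation attains its minimum on the compact set where the bound fails, and this
  -- minimum is positive. A tolerance with total below it avoids that set.
  · obtain ⟨q, hq, hmin⟩ := hc.exists_isMinOn hne (f := fun p => ∑ i, |d i p|)
      (continuous_finsetSum _ fun i _ => (hd i).abs).continuousOn
    have hpos : 0 < ∑ i, |d i q| := by
      refine lt_of_le_of_ne (sum_nonneg fun i _ => abs_nonneg _) fun h0 => ?_
      have := (sum_eq_zero_iff_of_nonneg fun i _ => abs_nonneg (d i q)).1 h0.symm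
      have := h q hq.1 fun i => abs_eq_zero.1 (this i (mem_univ i))
      have hq2 : g q ≤ R - ξ := hq.2
      linarith
    refine ⟨(∑ i, |d i q|) / (Fintype.card ι + 1), by positivity, fun p hp hle => ?_⟩
    by_contra! hlt
    have h1 : ∑ i, |d i q| ≤ ∑ i, |d i p| := hmin ⟨hp, hlt.le⟩
    have h2 : ∑ i, |d i p| ≤ Fintype.card ι * ((∑ i, |d i q|) / (Fintype.card ι + 1)) := by
      refine (sum_le_card_nsmul _ _ _ fun i _ => hle i).trans (le_of_eq ?_)
      rw [nsmul_eq_mul, card_univ]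
    have h3 : (Fintype.card ι : ℝ) * ((∑ i, |d i q|) / (Fintype.card ι + 1)) < ∑ i, |d i q| := by
      rw [mul_div_assoc', div_lt_iff₀ (by positivity)]
      nlinarith
    linarith

section Separation

open Joint

variable {X Y Z : Type*} [Fintype X] [Fintype Y] [Fintype Z]

/-- The conditions defining the attack set, and independence of X and Y, are zero sets of continuous
functions of the joint law once the free marginals are taken to be those of the law itself. The
compactness lemma is applied twice, since only the second bound may use independence. -/
theorem exists_separation_law {W : X → Y → Z → ℝ} {P₁ : X → ℝ}
    {P₂ : Y → ℝ} {R : ℝ × ℝ}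
    (hR : R ∈ rateRegion₁ W P₁ P₂) {ξ : ℝ} (hξ : 0 < ξ) :
    ∃ η > 0, ∀ p ∈ stdSimplex ℝ (Joint X Y Z),
      (∀ x y z, |law p (fun ω => (rX ω, rY' ω, rZ ω)) (x, y, z)
        - P₁ x * law p rY' y * W x y z| ≤ η) →
      (∀ x y z, |law p (fun ω => (rX' ω, rY ω, rZ ω)) (x, y, z)
        - law p rX' x * P₂ y * W x y z| ≤ η) →
      R.1 - ξ ≤ mutualInfo p rX rZ ∧
      ((∀ x y, |law p (fun ω => (rX ω, rY ω)) (x, y) - law p rX x * P₂ y| ≤ η) →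
        R.2 - ξ ≤ mutualInfo p rY fun ω => (rX ω, rZ ω)) := by
  obtain ⟨-, -, h1, h2⟩ := hR
  let d : (X × Y × Z) ⊕ (X × Y × Z) → (Joint X Y Z → ℝ) → ℝ := Sum.elim
    (fun q p => law p (fun ω => (rX ω, rY' ω, rZ ω)) q - P₁ q.1 * law p rY' q.2.1 * W q.1 q.2.1 q.2.2)
    (fun q p => law p (fun ω => (rX' ω, rY ω, rZ ω)) q - law p rX' q.1 * P₂ q.2.1 * W q.1 q.2.1 q.2.2)
  let d' : ((X × Y × Z) ⊕ (X × Y × Z)) ⊕ (X × Y) → (Joint X Y Z → ℝ) → ℝ := Sum.elim d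
    (fun q p => law p (fun ω => (rX ω, rY ω)) q - law p rX q.1 * P₂ q.2)
  have hd : ∀ i, Continuous (d i) := by
    rintro (q | q)
    · exact (continuous_law _ _).sub ((continuous_const.mul (continuous_law _ _)).mul_const _)
    · exact (continuous_law _ _).sub (((continuous_law _ _).mul_const _).mul_const _)
  have hd' : ∀ i, Continuous (d' i) := by
    rintro (q | q)
    · exact hd q
    · exact (continuous_law _ _).sub ((continuous_law _ _).mul_const _)
  have hmem : ∀ p ∈ stdSimplex ℝ (Joint X Y Z), (∀ i, d i p = 0) → p ∈ attackSet W P₁ P₂ :=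
    fun p hp h0 => ⟨hp,
      ⟨law p rY', law_mem hp _, fun x y z => sub_eq_zero.1 (h0 (Sum.inl (x, y, z)))⟩,
      ⟨law p rX', law_mem hp _, fun x y z => sub_eq_zero.1 (h0 (Sum.inr (x, y, z)))⟩⟩
  obtain ⟨η, hη, H⟩ := (isCompact_stdSimplex ℝ (Joint X Y Z)).exists_le_of_abs_le hd
    (continuousOn_mutualInfo rX rZ) (fun p hp h0 => h1 p (hmem p hp h0)) hξ
  obtain ⟨η', hη', H'⟩ := (isCompact_stdSimplex ℝ (Joint X Y Z)).exists_le_of_abs_le hd'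
    (continuousOn_mutualInfo rY fun ω => (rX ω, rZ ω)) (R := R.2) (fun p hp h0 => by
      have hi : IndepVars p rX rY := by
        have he : ∀ x y, law p (fun ω => (rX ω, rY ω)) (x, y) = law p rX x * P₂ y :=
          fun x y => sub_eq_zero.1 (h0 (Sum.inr (x, y)))
        have hY : ∀ y, law p rY y = P₂ y := fun y => by
          rw [← sum_law_fst p rX rY y]
          simp only [he]
          rw [← sum_mul, (law_mem hp rX).2, one_mul]
        intro x y
        rw [he, hY]
      rw [← condMutualInfo_eq_mutualInfo hp.1 hi]
      exact h2 p (hmem p hp fun i => h0 (Sum.inl i)) hi) hξ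
  refine ⟨min η η', lt_min hη hη', fun p hp a1 a2 => ⟨H p hp ?_, fun a3 => H' p hp ?_⟩⟩
  · rintro (⟨x, y, z⟩ | ⟨x, y, z⟩)
    · exact (a1 x y z).trans (min_le_left _ _)
    · exact (a2 x y z).trans (min_le_left _ _)
  · rintro ((⟨x, y, z⟩ | ⟨x, y, z⟩) | ⟨x, y⟩)
    · exact (a1 x y z).trans (min_le_right _ _)
    · exact (a2 x y z).trans (min_le_right _ _)
    · exact (a3 x y).trans (min_le_right _ _)

/-- `(x, z)` looks like the honest input of user 1 and the output under an attack of user 2. -/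
def ExplainedTwo (W : X → Y → Z → ℝ) (P₁ : X → ℝ) (η : ℝ) {n : ℕ} (x : Fin n → X)
    (z : Fin n → Z) : Prop :=
  ∃ y : Fin n → Y, Typical (fun y (q : X × Z) => P₁ q.1 * W q.1 y q.2) η y fun t => (x t, z t)

/-- `(y, z)` looks like the honest input of user 2 and the output under an attack of user 1. -/
def ExplainedOne (W : X → Y → Z → ℝ) (P₂ : Y → ℝ) (η : ℝ) {n : ℕ} (y : Fin n → Y)
    (z : Fin n → Z) : Prop :=
  ∃ x : Fin n → X, Typical (fun x (q : Y × Z) => P₂ q.1 * W x q.1 q.2) η x fun t => (y t, z t)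

theorem exists_separation {W : X → Y → Z → ℝ} {P₁ : X → ℝ}
    {P₂ : Y → ℝ} {R : ℝ × ℝ}
    (hR : R ∈ rateRegion₁ W P₁ P₂) {ξ : ℝ} (hξ : 0 < ξ) :
    ∃ η > 0, η ≤ 1 ∧ ∀ (n : ℕ), n ≠ 0 → ∀ (x : Fin n → X) (y : Fin n → Y) (z : Fin n → Z),
      ExplainedTwo W P₁ η x z → ExplainedOne W P₂ η y z →
      R.1 - ξ ≤ empInfo x z ∧
      (Typical (fun _ => P₂) η x y → R.2 - ξ ≤ empInfo y fun t => (x t, z t)) := by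
  obtain ⟨η, hη, H⟩ := exists_separation_law hR hξ
  refine ⟨min η 1, lt_min hη one_pos, min_le_right _ _, ?_⟩
  rintro n hn x y z ⟨y', h1⟩ ⟨x', h2⟩
  -- The sequences that explain z on behalf of the two possible adversaries play the roles of X̃ and
  -- Ỹ.
  have := H (emp fun t => (x t, y t, x' t, y' t, z t)) (emp_mem hn _)
  simp only [law_emp, mutualInfo_emp, rX, rY, rZ, rX', rY'] at this
  obtain ⟨a, b⟩ := this
    (fun i j k => by
      refine le_trans (le_of_eq ?_) ((h1 j (i, k)).trans (min_le_left _ _))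
      rw [← emp_comp_injective (fun t => (x t, y' t, z t)) (e := fun q => (q.2.1, q.1, q.2.2))
        (fun q r => by simp +contextual [Prod.ext_iff])]
      congr 1
      ring)
    (fun i j k => by
      refine le_trans (le_of_eq ?_) ((h2 i (j, k)).trans (min_le_left _ _))
      congr 1
      ring)
  exact ⟨a, fun h => b fun i j => (h i j).trans (min_le_left _ _)⟩

end Separation

/-! ### Codes with arbitrary message sets and output probabilities -/

/-- Decoder outputs over arbitrary message sets. -/
inductive Verdict (M₁ M₂ : Type*)
  | pair (m₁ : M₁) (m₂ : M₂)
  | one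
  | two

namespace Verdict

variable {M₁ M₂ : Type*}

/-- Exchange the roles of the two users. -/
def swap : Verdict M₁ M₂ → Verdict M₂ M₁
  | pair m₁ m₂ => pair m₂ m₁
  | one => two
  | two => one

/-- The outputs that are wrong if user 1 is adversarial and user 2 sends `m₂`. -/
def BadOne (m₂ : M₂) (v : Verdict M₁ M₂) : Prop := ¬ ((∃ m₁, v = pair m₁ m₂) ∨ v = one)

/-- The outputs that are wrong if user 2 is adversarial and user 1 sends `m₁`. -/
def BadTwo (m₁ : M₁) (v : Verdict M₁ M₂) : Prop := ¬ ((∃ m₂, v = pair m₁ m₂) ∨ v = two)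

theorem badOne_swap (m₁ : M₁) (v : Verdict M₁ M₂) : BadOne m₁ v.swap ↔ BadTwo m₁ v := by
  cases v <;> simp [BadOne, BadTwo, swap]

end Verdict

open Verdict

section Channel

variable {X Y Z : Type*} [Fintype Z] {n : ℕ}

theorem prodProb_eq_prob (W : X → Y → Z → ℝ) (x : Fin n → X) (y : Fin n → Y)
    (E : Set (Fin n → Z)) :
    prodProb W x y E = prob (piW fun t => W (x t) (y t)) fun z => z ∈ E := by
  simp only [prodProb, prob, avg, piW]
  exact sum_congr rfl fun z _ => by split_ifs <;> simp

/-- The probability of an output event under the product channel. -/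
def outProb (W : X → Y → Z → ℝ) (x : Fin n → X) (y : Fin n → Y) (E : (Fin n → Z) → Prop) : ℝ :=
  prob (piW fun t => W (x t) (y t)) E

theorem piW_channel_mem {W : X → Y → Z → ℝ} (hW : IsMAC W) (x : Fin n → X) (y : Fin n → Y) :
    (piW fun t => W (x t) (y t)) ∈ stdSimplex ℝ (Fin n → Z) :=
  piW_mem fun t => hW (x t) (y t)

theorem avg_piW_append {A : Type*} [Fintype A] {m : ℕ} (w : Fin (m + n) → A → ℝ)
    (f : (Fin (m + n) → A) → ℝ) :
    avg (piW w) f = avg (piW fun t => w (Fin.castAdd n t)) fun a =>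
      avg (piW fun t => w (Fin.natAdd m t)) fun b => f (Fin.append a b) := by
  simp only [avg, mul_sum]
  rw [← Fintype.sum_prod_type' (f := fun (a : Fin m → A) (b : Fin n → A) =>
      piW (fun t => w (Fin.castAdd n t)) a * (piW (fun t => w (Fin.natAdd m t)) b *
        f (Fin.append a b))), ← Equiv.sum_comp (Fin.appendEquiv m n)]
  refine sum_congr rfl fun q _ => ?_
  simp [piW, Fin.appendEquiv, Fin.prod_univ_add, mul_assoc]

end Channel

/-- A code with arbitrary message sets. -/
structure UCode (X Y Z M₁ M₂ : Type*) (n : ℕ) where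
  /-- encoder of user 1 -/
  enc₁ : M₁ → Fin n → X
  /-- encoder of user 2 -/
  enc₂ : M₂ → Fin n → Y
  /-- decoder -/
  dec : (Fin n → Z) → Verdict M₁ M₂

/-- The average error probabilities under attack are at most `ε`. -/
def UCode.Reliable {X Y Z M₁ M₂ : Type*} [Fintype Z] [Fintype M₁] [Fintype M₂] {n : ℕ}
    (W : X → Y → Z → ℝ) (c : UCode X Y Z M₁ M₂ n) (ε : ℝ) : Prop :=
  (∀ x, ∑ m₂, outProb W x (c.enc₂ m₂) (fun z => BadOne m₂ (c.dec z)) ≤ ε * Fintype.card M₂) ∧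
  (∀ y, ∑ m₁, outProb W (c.enc₁ m₁) y (fun z => BadTwo m₁ (c.dec z)) ≤ ε * Fintype.card M₁)

/-! ### Prefixing a family of codes by a code that transmits its keys -/

section Concatenation

variable {X Y Z K₁ K₂ N₁ N₂ : Type*} {m n : ℕ}

/-- The decoder of a concatenated code whose second part depends on the messages of the first. -/
def concatDec (d₀ : (Fin m → Z) → Verdict K₁ K₂) (d : K₁ → K₂ → (Fin n → Z) → Verdict N₁ N₂)
    (z : Fin (m + n) → Z) : Verdict (K₁ × N₁) (K₂ × N₂) :=
  match d₀ fun t => z (Fin.castAdd n t) with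
  | pair k₁ k₂ =>
    match d k₁ k₂ fun t => z (Fin.natAdd m t) with
    | pair j₁ j₂ => pair (k₁, j₁) (k₂, j₂)
    | one => one
    | two => two
  | one => one
  | two => two

theorem swap_concatDec (d₀ : (Fin m → Z) → Verdict K₁ K₂)
    (d : K₁ → K₂ → (Fin n → Z) → Verdict N₁ N₂) (z : Fin (m + n) → Z) :
    (concatDec d₀ d z).swap
      = concatDec (fun z => (d₀ z).swap) (fun k₂ k₁ z => (d k₁ k₂ z).swap) z := by
  simp only [concatDec]
  rcases d₀ fun t => z (Fin.castAdd n t) with ⟨k₁, k₂⟩ | _ | _ <;> simp only [swap]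
  rcases d k₁ k₂ fun t => z (Fin.natAdd m t) with ⟨j₁, j₂⟩ | _ | _ <;> rfl

/-- A prefix decoder that does not err against adversarial user 1 either blames user 1, and then the
whole verdict is right, or returns the true key of user 2 with some key of user 1. -/
theorem badOne_concatDec {d₀ : (Fin m → Z) → Verdict K₁ K₂}
    {d : K₁ → K₂ → (Fin n → Z) → Verdict N₁ N₂} {z : Fin m → Z} {z' : Fin n → Z} {k₂ : K₂}
    {j₂ : N₂} (h : BadOne (k₂, j₂) (concatDec d₀ d (Fin.append z z')))
    (h₀ : ¬ BadOne k₂ (d₀ z)) : ∃ k₁, d₀ z = pair k₁ k₂ ∧ BadOne j₂ (d k₁ k₂ z') := by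
  simp only [concatDec, Fin.append_left, Fin.append_right] at h
  rcases hz : d₀ z with ⟨k₁, k₂'⟩ | _ | _
  · rw [hz] at h h₀
    simp only [BadOne, pair.injEq, reduceCtorEq, or_false, not_exists, not_and, not_forall,
      not_not] at h₀
    obtain ⟨_, _, rfl⟩ := h₀
    refine ⟨k₁, rfl, ?_⟩
    simp only at h
    rcases hz' : d k₁ k₂' z' with ⟨j₁, j₂'⟩ | _ | _ <;> rw [hz'] at h <;> simp_all [BadOne]
  · rw [hz] at h; simp [BadOne] at h
  · rw [hz] at h₀; simp [BadOne] at h₀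

variable [Fintype Z] [Fintype K₂] [Fintype N₂]

/-- Prefix errors are charged in full. Otherwise the second decoder works with the true k₂ and with
a k₁ that the attack and the noise may select, which is why `G` must not depend on k₁. -/
theorem sum_badOne_concatDec_le {W : X → Y → Z → ℝ} (hW : IsMAC W) {b₀ : K₂ → Fin m → Y}
    {b : K₂ → N₂ → Fin n → Y} {d₀ : (Fin m → Z) → Verdict K₁ K₂}
    {d : K₁ → K₂ → (Fin n → Z) → Verdict N₁ N₂} {ε ε' : ℝ} (x : Fin m → X) (x' : Fin n → X)
    (h₀ : ∑ k, outProb W x (b₀ k) (fun z => BadOne k (d₀ z)) ≤ ε * Fintype.card K₂)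
    {G : K₂ → ℝ} (hG : ∀ k, 0 ≤ G k) (hGs : ∑ k, G k ≤ ε' * Fintype.card K₂)
    (hGd : ∀ k₁ k₂, ∑ j, outProb W x' (b k₂ j) (fun z => BadOne j (d k₁ k₂ z))
      ≤ Fintype.card N₂ * G k₂) :
    ∑ q : K₂ × N₂, outProb W (Fin.append x x') (Fin.append (b₀ q.1) (b q.1 q.2))
      (fun z => BadOne q (concatDec d₀ d z)) ≤ (ε + ε') * Fintype.card (K₂ × N₂) := by
  have key : ∀ k, ∑ j, outProb W (Fin.append x x') (Fin.append (b₀ k) (b k j))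
      (fun z => BadOne (k, j) (concatDec d₀ d z))
      ≤ Fintype.card N₂ * outProb W x (b₀ k) (fun z => BadOne k (d₀ z))
        + Fintype.card N₂ * G k := by
    intro k
    simp only [outProb, prob]
    simp only [avg_piW_append, Fin.append_left, Fin.append_right]
    rw [← avg_sum, ← avg_const_mul,
      ← avg_const (piW_channel_mem hW x (b₀ k)) (Fintype.card N₂ * G k), ← avg_add]
    refine avg_mono (piW_channel_mem hW x (b₀ k)) fun z => ?_
    by_cases hz : BadOne k (d₀ z)
    · have : ∑ j, prob (piW fun t => W (x' t) (b k j t))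
          (fun z' => BadOne (k, j) (concatDec d₀ d (Fin.append z z'))) ≤ Fintype.card N₂ := by
        refine (sum_le_card_nsmul _ _ 1 fun j _ => prob_le_one (piW_channel_mem hW _ _) _).trans ?_
        simp
      rw [if_pos hz]
      simp only [prob] at this
      have := hG k
      have : (0 : ℝ) ≤ Fintype.card N₂ * G k := by positivity
      linarith
    · rw [if_neg hz, mul_zero, zero_add]
      by_cases hk : ∃ k₁, d₀ z = pair k₁ k
      · obtain ⟨k₁, hk⟩ := hk
        refine le_trans (sum_le_sum fun j _ => ?_) (hGd k₁ k)
        refine prob_mono (piW_channel_mem hW _ _) fun z' hz' => ?_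
        obtain ⟨k₁', h1, h2⟩ := badOne_concatDec hz' hz
        obtain ⟨rfl, -⟩ : k₁ = k₁' ∧ k = k := by simpa [hk] using h1
        exact h2
      · have hn : ∀ j z', ¬ BadOne (k, j) (concatDec d₀ d (Fin.append z z')) := fun j z' h => by
          obtain ⟨k₁, h1, -⟩ := badOne_concatDec h hz
          exact hk ⟨k₁, h1⟩
        simp only [hn, if_false, avg, mul_zero, sum_const_zero]
        exact mul_nonneg (Nat.cast_nonneg _) (hG k)
  rw [Fintype.sum_prod_type]
  refine (sum_le_sum fun k _ => key k).trans ?_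
  rw [sum_add_distrib, ← mul_sum, ← mul_sum, Fintype.card_prod]
  push_cast
  nlinarith [mul_le_mul_of_nonneg_left h₀ (Nat.cast_nonneg (α := ℝ) (Fintype.card N₂)),
    mul_le_mul_of_nonneg_left hGs (Nat.cast_nonneg (α := ℝ) (Fintype.card N₂))]

/-- The concatenation of a code with a family of codes indexed by its messages. -/
def UCode.concat (c : UCode X Y Z K₁ K₂ m) (a : K₁ → N₁ → Fin n → X) (b : K₂ → N₂ → Fin n → Y)
    (d : K₁ → K₂ → (Fin n → Z) → Verdict N₁ N₂) : UCode X Y Z (K₁ × N₁) (K₂ × N₂) (m + n) where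
  enc₁ q := Fin.append (c.enc₁ q.1) (a q.1 q.2)
  enc₂ q := Fin.append (c.enc₂ q.1) (b q.1 q.2)
  dec := concatDec c.dec d

variable [Fintype K₁] [Fintype N₁]

/-- The family of codes with encoders `a k₁`, `b k₂` and decoders `d k₁ k₂` has small error
on average over the key of the honest user, for the worst key of the adversarial user. -/
def KeyedReliable (W : X → Y → Z → ℝ) (a : K₁ → N₁ → Fin n → X) (b : K₂ → N₂ → Fin n → Y)
    (d : K₁ → K₂ → (Fin n → Z) → Verdict N₁ N₂) (ε : ℝ) : Prop :=
  (∀ x, ∃ G : K₂ → ℝ, (∀ k, 0 ≤ G k) ∧ ∑ k, G k ≤ ε * Fintype.card K₂ ∧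
    ∀ k₁ k₂, ∑ j, outProb W x (b k₂ j) (fun z => BadOne j (d k₁ k₂ z))
      ≤ Fintype.card N₂ * G k₂) ∧
  (∀ y, ∃ G : K₁ → ℝ, (∀ k, 0 ≤ G k) ∧ ∑ k, G k ≤ ε * Fintype.card K₁ ∧
    ∀ k₁ k₂, ∑ j, outProb W (a k₁ j) y (fun z => BadTwo j (d k₁ k₂ z))
      ≤ Fintype.card N₁ * G k₁)

theorem UCode.Reliable.concat {W : X → Y → Z → ℝ} (hW : IsMAC W) {c : UCode X Y Z K₁ K₂ m}
    {a : K₁ → N₁ → Fin n → X} {b : K₂ → N₂ → Fin n → Y}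
    {d : K₁ → K₂ → (Fin n → Z) → Verdict N₁ N₂} {ε ε' : ℝ} (hc : c.Reliable W ε)
    (hd : KeyedReliable W a b d ε') : (c.concat a b d).Reliable W (ε + ε') := by
  constructor
  · intro x
    obtain ⟨x, x', rfl⟩ : ∃ u u', x = Fin.append u u' :=
      ⟨_, _, (Fin.append_castAdd_natAdd (f := x)).symm⟩
    obtain ⟨G, h0, h1, h2⟩ := hd.1 x'
    exact sum_badOne_concatDec_le hW x x' (hc.1 x) h0 h1 h2
  · intro y
    obtain ⟨y, y', rfl⟩ : ∃ u u', y = Fin.append u u' :=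
      ⟨_, _, (Fin.append_castAdd_natAdd (f := y)).symm⟩
    obtain ⟨G, h0, h1, h2⟩ := hd.2 y'
    have hc' := hc.2 y
    simp only [← badOne_swap] at hc' h2
    have := sum_badOne_concatDec_le (W := fun y x => W x y) (fun y x => hW x y) (b₀ := c.enc₁)
      (b := a) (d₀ := fun z => (c.dec z).swap) (d := fun k₂ k₁ z => (d k₁ k₂ z).swap) y y' hc' h0 h1
      fun k₂ k₁ => h2 k₁ k₂
    simp only [← swap_concatDec, badOne_swap] at this
    exact this

theorem UCode.Reliable.keyed {W : X → Y → Z → ℝ} {c : UCode X Y Z N₁ N₂ n} {ε : ℝ} (h0 : 0 ≤ ε)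
    (hc : c.Reliable W ε) :
    KeyedReliable W (fun _ : K₁ => c.enc₁) (fun _ : K₂ => c.enc₂) (fun _ _ => c.dec) ε :=
  ⟨fun x => ⟨fun _ => ε, fun _ => h0, by simp [mul_comm],
      fun _ _ => (hc.1 x).trans_eq (mul_comm _ _)⟩,
    fun y => ⟨fun _ => ε, fun _ => h0, by simp [mul_comm],
      fun _ _ => (hc.2 y).trans_eq (mul_comm _ _)⟩⟩

end Concatenation

/-! ### Passing to subcodes of prescribed size -/

section RateReduction

/-- A subset of prescribed size on which finitely many `[0,1]`-valued functions have averages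
comparable with their overall averages. -/
theorem exists_injective_sum_le {M S : Type*} [Fintype M] [Fintype S] {g : S → M → ℝ}
    (h0 : ∀ s m, 0 ≤ g s m) (h1 : ∀ s m, g s m ≤ 1) {ε : ℝ} (hε : 0 ≤ ε)
    (hg : ∀ s, ∑ m, g s m ≤ ε * Fintype.card M) {N : ℕ} (hN : 0 < N) (hNM : N ≤ Fintype.card M)
    (hS : Fintype.card S * Real.exp (-(ε * N)) < 1) :
    ∃ σ : Fin N → M, Function.Injective σ ∧ ∀ s, ∑ i, g s (σ i) ≤ 5 * ε * N := by
  -- M contains N disjoint blocks of q elements; one element is drawn from each, so the choices are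
  -- independent and distinct. The blocks cover at least half of M.
  set q := Fintype.card M / N with hq
  have hq0 : 0 < q := Nat.div_pos hNM hN
  obtain ⟨e⟩ : Nonempty (Fin N × Fin q ↪ M) := Function.Embedding.nonempty_of_card_le (by
    simpa using Nat.mul_div_le (Fintype.card M) N)
  have hM : (Fintype.card M : ℝ) ≤ 2 * N * q := by
    have h2 : Fintype.card M < N * (q + 1) := Nat.lt_mul_div_succ _ hN
    have h3 : N * (q + 1) ≤ 2 * N * q := by nlinarith
    exact_mod_cast (h2.trans_le h3).le
  have hq' : (0 : ℝ) < q := by exact_mod_cast hq0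
  -- The means sum to at most 2εN by the covering of half of M, and 2 · 2εN − 5εN = −εN is the
  -- exponent in `hS`.
  obtain ⟨c, -, hc⟩ := exists_forall_sum_lt (ι := Fin N) (w := fun _ (_ : Fin q) => 1 / (q : ℝ))
    (g := fun s i j => g s (e (i, j))) (μ := 2 * ε * N) (t := 5 * ε * N)
    (fun i => ⟨fun _ => by positivity, by simp [hq'.ne']⟩) (fun s i j => h0 _ _)
    (fun s i j => h1 _ _) (fun s => by
      simp only [avg, ← mul_sum]
      rw [← Fintype.sum_prod_type' (f := fun i j => g s (e (i, j))), one_div,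
        inv_mul_le_iff₀ hq']
      have : ∑ p : Fin N × Fin q, g s (e p) ≤ ∑ m, g s m := by
        rw [← sum_map univ e (g s)]
        exact sum_le_sum_of_subset_of_nonneg (subset_univ _) fun m _ _ => h0 s m
      nlinarith [hg s, mul_le_mul_of_nonneg_left hM hε])
    (by convert hS using 3; ring)
  refine ⟨fun i => e (i, c i), fun i j hij => ?_, fun s => (hc s).le⟩
  exact congrArg Prod.fst (e.injective hij)

variable {X Y Z M₁ M₂ : Type*} {n : ℕ}

/-- The decoder of a subcode: messages outside the subcode are blamed on their sender. -/
def subDec {N₁ N₂ : ℕ} (σ₁ : Fin N₁ → M₁) (σ₂ : Fin N₂ → M₂) : Verdict M₁ M₂ → Output N₁ N₂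
  | pair m₁ m₂ =>
    if h₁ : ∃ i, σ₁ i = m₁ then
      if h₂ : ∃ i, σ₂ i = m₂ then Output.msgs h₁.choose h₂.choose else Output.blameTwo
    else Output.blameOne
  | one => Output.blameOne
  | two => Output.blameTwo

/-- Restriction of a code to subsets of the message sets. -/
def UCode.sub (c : UCode X Y Z M₁ M₂ n) {N₁ N₂ : ℕ} (σ₁ : Fin N₁ → M₁) (σ₂ : Fin N₂ → M₂) :
    Code X Y Z N₁ N₂ n where
  enc₁ i := c.enc₁ (σ₁ i)
  enc₂ i := c.enc₂ (σ₂ i)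
  dec z := subDec σ₁ σ₂ (c.dec z)

theorem choose_eq_of_injective {α β : Type*} {σ : α → β} (hσ : Function.Injective σ) {i : α}
    {b : β} (h : ∃ j, σ j = b) (hb : b = σ i) : h.choose = i :=
  hσ (h.choose_spec.trans hb)

/-- The message of the honest user always belongs to the subcode, so only the adversary can be
blamed for a message outside it. -/
theorem UCode.badOne_of_sub {c : UCode X Y Z M₁ M₂ n} {N₁ N₂ : ℕ} {σ₁ : Fin N₁ → M₁}
    {σ₂ : Fin N₂ → M₂} (h₂ : Function.Injective σ₂) {i : Fin N₂} {z : Fin n → Z}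
    (h : z ∈ (c.sub σ₁ σ₂).errMalOne i) : BadOne (σ₂ i) (c.dec z) := by
  rintro (⟨m₁, hz⟩ | hz) <;> refine h ?_ <;> simp only [UCode.sub, hz, subDec]
  · by_cases e₁ : ∃ j, σ₁ j = m₁
    · have e₂ : ∃ j, σ₂ j = σ₂ i := ⟨i, rfl⟩
      rw [dif_pos e₁, dif_pos e₂, choose_eq_of_injective h₂ e₂ rfl]
      exact Or.inl ⟨_, rfl⟩
    · rw [dif_neg e₁]
      exact Or.inr rfl
  · exact Or.inr trivial

theorem UCode.badTwo_of_sub {c : UCode X Y Z M₁ M₂ n} {N₁ N₂ : ℕ} {σ₁ : Fin N₁ → M₁}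
    {σ₂ : Fin N₂ → M₂} (h₁ : Function.Injective σ₁) {i : Fin N₁} {z : Fin n → Z}
    (h : z ∈ (c.sub σ₁ σ₂).errMalTwo i) : BadTwo (σ₁ i) (c.dec z) := by
  rintro (⟨m₂, hz⟩ | hz) <;> refine h ?_ <;> simp only [UCode.sub, hz, subDec]
  · have e₁ : ∃ j, σ₁ j = σ₁ i := ⟨i, rfl⟩
    rw [dif_pos e₁]
    by_cases e₂ : ∃ j, σ₂ j = m₂
    · rw [dif_pos e₂, choose_eq_of_injective h₁ e₁ rfl]
      exact Or.inl ⟨_, rfl⟩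
    · rw [dif_neg e₂]
      exact Or.inr rfl
  · exact Or.inr trivial

variable [Fintype Z]

/-- A wrong output with both users honest is an error against one of the two attacks: blaming a user
is wrong if the other is the adversary. The honest error is thus at most the sum of the two attack
errors, each evaluated at codewords as attacks. -/
theorem Code.pe_le [Nonempty X] [Nonempty Y] {W : X → Y → Z → ℝ} (hW : IsMAC W) {N₁ N₂ : ℕ}
    (h₁ : 0 < N₁) (h₂ : 0 < N₂) {c : Code X Y Z N₁ N₂ n} {ε : ℝ} (hε : 0 ≤ ε)
    (hone : ∀ x, ∑ i, prodProb W x (c.enc₂ i) (c.errMalOne i) ≤ ε * N₂)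
    (htwo : ∀ y, ∑ i, prodProb W (c.enc₁ i) y (c.errMalTwo i) ≤ ε * N₁) : c.pe W ≤ 2 * ε := by
  have h₁' : (0 : ℝ) < N₁ := by exact_mod_cast h₁
  have h₂' : (0 : ℝ) < N₂ := by exact_mod_cast h₂
  refine max_le ?_ (max_le (ciSup_le fun x => ?_) (ciSup_le fun y => ?_))
  · have hsum : ∑ i, ∑ j, prodProb W (c.enc₁ i) (c.enc₂ j) (c.errHonest i j)
        ≤ 2 * ε * (N₁ * N₂) := by
      calc _ ≤ ∑ i, ∑ j, (prodProb W (c.enc₁ i) (c.enc₂ j) (c.errMalOne j)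
              + prodProb W (c.enc₁ i) (c.enc₂ j) (c.errMalTwo i)) := by
            refine sum_le_sum fun i _ => sum_le_sum fun j _ => ?_
            simp only [prodProb_eq_prob]
            refine le_trans (prob_mono (piW_channel_mem hW _ _) fun z hz => ?_)
              (prob_or_le (piW_channel_mem hW _ _) _ _)
            simp only [Code.errHonest, Code.errMalOne, Code.errMalTwo, Set.mem_ofPred_eq] at hz ⊢
            generalize c.dec z = v at hz ⊢
            rcases v with ⟨i', j'⟩ | _ | _ <;> simp at hz ⊢
            tauto
        _ ≤ ∑ i : Fin N₁, ε * N₂ + ∑ j : Fin N₂, ε * N₁ := by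
            simp only [sum_add_distrib]
            refine add_le_add (sum_le_sum fun i _ => hone _) ?_
            rw [sum_comm]
            exact sum_le_sum fun j _ => htwo _
        _ = _ := by simp; ring
    rw [Code.peHonest, one_div, inv_mul_le_iff₀ (by positivity)]
    linarith
  · rw [one_div, inv_mul_le_iff₀ h₂']
    nlinarith [hone x]
  · rw [one_div, inv_mul_le_iff₀ h₁']
    nlinarith [htwo y]

theorem Code.pe_nonneg {W : X → Y → Z → ℝ} (hW : IsMAC W) {N₁ N₂ : ℕ} (c : Code X Y Z N₁ N₂ n) :
    0 ≤ c.pe W := by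
  refine le_max_of_le_left (mul_nonneg (by positivity) ?_)
  refine sum_nonneg fun i _ => sum_nonneg fun j _ => ?_
  rw [prodProb_eq_prob]
  exact prob_nonneg (piW_channel_mem hW _ _) _

/-- A random subcode of each message set retains the error bound up to a factor 5 simultaneously for
all attack sequences; the factor 2 from `Code.pe_le` makes 10. -/
theorem UCode.Reliable.exists_code [Fintype X] [Fintype Y] [Nonempty X] [Nonempty Y] [Fintype M₁]
    [Fintype M₂] {W : X → Y → Z → ℝ} (hW : IsMAC W) {c : UCode X Y Z M₁ M₂ n} {ε : ℝ}
    (hε : 0 ≤ ε) (hc : c.Reliable W ε) {N₁ N₂ : ℕ} (h₁ : 0 < N₁) (h₂ : 0 < N₂)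
    (hN₁ : N₁ ≤ Fintype.card M₁) (hN₂ : N₂ ≤ Fintype.card M₂)
    (hY : (Fintype.card Y : ℝ) ^ n * Real.exp (-(ε * N₁)) < 1)
    (hX : (Fintype.card X : ℝ) ^ n * Real.exp (-(ε * N₂)) < 1) :
    ∃ c' : Code X Y Z N₁ N₂ n, c'.pe W ≤ 10 * ε := by
  obtain ⟨σ₁, i₁, s₁⟩ := exists_injective_sum_le
    (g := fun y m => outProb W (c.enc₁ m) y fun z => BadTwo m (c.dec z))
    (fun y m => prob_nonneg (piW_channel_mem hW _ _) _)
    (fun y m => prob_le_one (piW_channel_mem hW _ _) _) hε hc.2 h₁ hN₁ (by simpa using hY)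
  obtain ⟨σ₂, i₂, s₂⟩ := exists_injective_sum_le
    (g := fun x m => outProb W x (c.enc₂ m) fun z => BadOne m (c.dec z))
    (fun y m => prob_nonneg (piW_channel_mem hW _ _) _)
    (fun y m => prob_le_one (piW_channel_mem hW _ _) _) hε hc.1 h₂ hN₂ (by simpa using hX)
  refine ⟨c.sub σ₁ σ₂, (Code.pe_le hW h₁ h₂ (ε := 5 * ε) (by positivity) (fun x => ?_)
    fun y => ?_).trans_eq (by ring)⟩
  · refine le_trans (sum_le_sum fun i _ => ?_) (s₂ x)
    rw [prodProb_eq_prob]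
    exact prob_mono (piW_channel_mem hW _ _) fun z hz => UCode.badOne_of_sub i₂ hz
  · refine le_trans (sum_le_sum fun i _ => ?_) (s₁ y)
    rw [prodProb_eq_prob]
    exact prob_mono (piW_channel_mem hW _ _) fun z hz => UCode.badTwo_of_sub i₁ hz

/-- The verdict that corresponds to a decoder output. -/
def Output.toVerdict {N₁ N₂ : ℕ} : Output N₁ N₂ → Verdict (Fin N₁) (Fin N₂)
  | msgs m₁ m₂ => pair m₁ m₂
  | blameOne => one
  | blameTwo => two

theorem Code.reliable_of_pe_le [Finite X] [Finite Y] {W : X → Y → Z → ℝ} {N₁ N₂ : ℕ}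
    (h₁ : 0 < N₁) (h₂ : 0 < N₂) {c : Code X Y Z N₁ N₂ n} {ε : ℝ} (hc : c.pe W ≤ ε) :
    UCode.Reliable W ⟨c.enc₁, c.enc₂, fun z => (c.dec z).toVerdict⟩ ε := by
  have h₁' : (0 : ℝ) < N₁ := by exact_mod_cast h₁
  have h₂' : (0 : ℝ) < N₂ := by exact_mod_cast h₂
  constructor
  · intro x
    have h := (le_ciSup (f := fun x : Fin n → X =>
      1 / (N₂ : ℝ) * ∑ m₂, prodProb W x (c.enc₂ m₂) (c.errMalOne m₂))
      (Set.finite_range _).bddAbove x).trans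
      (((le_max_left _ _).trans (le_max_right _ _)).trans hc)
    rw [one_div, inv_mul_le_iff₀ h₂'] at h
    rw [Fintype.card_fin, mul_comm]
    refine le_trans (le_of_eq (sum_congr rfl fun i _ => ?_)) h
    rw [prodProb_eq_prob, outProb]
    congr 1
    funext z
    simp only [Code.errMalOne, BadOne, Set.mem_ofPred_eq]
    rcases c.dec z with _ | _ | _ <;> simp [Output.toVerdict]
  · intro y
    have h := (le_ciSup (f := fun y : Fin n → Y =>
      1 / (N₁ : ℝ) * ∑ m₁, prodProb W (c.enc₁ m₁) y (c.errMalTwo m₁))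
      (Set.finite_range _).bddAbove y).trans
      (((le_max_right _ _).trans (le_max_right _ _)).trans hc)
    rw [one_div, inv_mul_le_iff₀ h₁'] at h
    rw [Fintype.card_fin, mul_comm]
    refine le_trans (le_of_eq (sum_congr rfl fun i _ => ?_)) h
    rw [prodProb_eq_prob, outProb]
    congr 1
    funext z
    simp only [Code.errMalTwo, BadTwo, Set.mem_ofPred_eq]
    rcases c.dec z with _ | _ | _ <;> simp [Output.toVerdict]

end RateReduction

/-! ### Growth estimates and block splitting -/

section Growth

open Filter Topology

theorem half_le_floor {t : ℝ} (ht : 1 ≤ t) : t / 2 ≤ (⌊t⌋₊ : ℝ) := by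
  have h1 : (1 : ℝ) ≤ ⌊t⌋₊ := by exact_mod_cast (Nat.one_le_floor_iff t).2 ht
  linarith [Nat.lt_floor_add_one t]

theorem one_le_two_rpow {x : ℝ} (hx : 0 ≤ x) : (1 : ℝ) ≤ (2 : ℝ) ^ x :=
  Real.one_le_rpow one_le_two hx

theorem floor_two_rpow_pos {x : ℝ} (hx : 0 ≤ x) : 0 < ⌊(2 : ℝ) ^ x⌋₊ :=
  Nat.floor_pos.2 (one_le_two_rpow hx)

/-- Exponentials dominate powers. -/
theorem tendsto_pow_mul_two_rpow_neg {γ : ℝ} (hγ : 0 < γ) (k : ℕ) :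
    Tendsto (fun n : ℕ => (n : ℝ) ^ k * (2 : ℝ) ^ (-(n * γ))) atTop (𝓝 0) := by
  have h := tendsto_pow_const_mul_const_pow_of_abs_lt_one k
    (r := (2 : ℝ) ^ (-γ)) (by
      rw [abs_of_pos (by positivity)]
      exact Real.rpow_lt_one_of_one_lt_of_neg one_lt_two (by linarith))
  refine h.congr fun n => ?_
  rw [← Real.rpow_natCast ((2 : ℝ) ^ (-γ)), ← Real.rpow_mul two_pos.le]
  ring_nf

theorem eventually_sq_le_floor {ρ : ℝ} (hρ : 0 < ρ) (C : ℝ) :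
    ∀ᶠ n : ℕ in atTop, (C * (n + 1)) ^ 2 ≤ (⌊(2 : ℝ) ^ (n * ρ)⌋₊ : ℝ) := by
  have h2 : Tendsto (fun n : ℕ => (8 * C ^ 2) * ((n : ℝ) ^ 2 * (2 : ℝ) ^ (-(n * ρ)))) atTop (𝓝 0) := by
    simpa using (tendsto_pow_mul_two_rpow_neg hρ 2).const_mul (8 * C ^ 2)
  filter_upwards [h2.eventually (ge_mem_nhds one_pos), eventually_ge_atTop 1] with n hn h1
  have h1' : (1 : ℝ) ≤ n := by exact_mod_cast h1
  refine le_trans ?_ (half_le_floor (one_le_two_rpow (by positivity)))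
  rw [Real.rpow_neg two_pos.le, ← mul_assoc, mul_inv_le_iff₀ (by positivity)] at hn
  have : (C * (n + 1)) ^ 2 ≤ C ^ 2 * (4 * n ^ 2) := by
    rw [mul_pow]
    exact mul_le_mul_of_nonneg_left (by nlinarith) (sq_nonneg C)
  linarith

theorem eventually_pow_mul_exp_lt_one (C : ℕ) {ε : ℝ} (hε : 0 < ε) :
    ∀ᶠ n : ℕ in atTop, ∀ N : ℝ, (n : ℝ) ^ 2 ≤ N → (C : ℝ) ^ n * Real.exp (-(ε * N)) < 1 := by
  filter_upwards [eventually_gt_atTop ⌈C / ε⌉₊] with n hn N hN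
  have hn' : C / ε < n := Nat.lt_of_ceil_lt hn
  have hn0 : (0 : ℝ) < n := lt_of_le_of_lt (by positivity) hn'
  rw [div_lt_iff₀ hε] at hn'
  calc (C : ℝ) ^ n * Real.exp (-(ε * N)) ≤ Real.exp C ^ n * Real.exp (-(ε * N)) :=
        mul_le_mul_of_nonneg_right (pow_le_pow_left₀ (Nat.cast_nonneg C)
          (by linarith [Real.add_one_le_exp (C : ℝ)]) n) (Real.exp_pos _).le
    _ = Real.exp (n * C - ε * N) := by rw [← Real.exp_nat_mul, ← Real.exp_add]; rfl
    _ < 1 := by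
        rw [Real.exp_lt_one_iff]
        nlinarith [mul_le_mul_of_nonneg_left hN hε.le]

theorem tendsto_floor_mul {κ : ℝ} (hκ : 0 < κ) :
    Tendsto (fun n : ℕ => ⌊κ * (n : ℝ)⌋₊) atTop atTop :=
  tendsto_nat_floor_atTop.comp (tendsto_natCast_atTop_atTop.const_mul_atTop hκ)

theorem floor_mul_le {κ : ℝ} (h0 : 0 ≤ κ) (n : ℕ) : (⌊κ * n⌋₊ : ℝ) ≤ κ * n :=
  Nat.floor_le (by positivity)

theorem cast_sub_floor_mul {κ : ℝ} (h0 : 0 ≤ κ) (h1 : κ ≤ 1) (n : ℕ) :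
    ((n - ⌊κ * n⌋₊ : ℕ) : ℝ) = n - ⌊κ * n⌋₊ := by
  refine Nat.cast_sub ?_
  have := floor_mul_le h0 n
  have : (⌊κ * n⌋₊ : ℝ) ≤ n := this.trans (by nlinarith [Nat.cast_nonneg (α := ℝ) n])
  exact_mod_cast this

theorem tendsto_sub_floor_mul {κ : ℝ} (h0 : 0 ≤ κ) (h1 : κ < 1) :
    Tendsto (fun n : ℕ => n - ⌊κ * (n : ℝ)⌋₊) atTop atTop := by
  refine tendsto_atTop_mono (f := fun n : ℕ => ⌊(1 - κ) * (n : ℝ)⌋₊) (fun n => ?_)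
    (tendsto_floor_mul (by linarith))
  have h2 : ((⌊(1 - κ) * n⌋₊ : ℕ) : ℝ) ≤ ((n - ⌊κ * n⌋₊ : ℕ) : ℝ) := by
    rw [cast_sub_floor_mul h0 h1.le]
    linarith [floor_mul_le h0 n, floor_mul_le (by linarith : 0 ≤ 1 - κ) n]
  exact_mod_cast h2

/-- Rounding moves less than one symbol from the first part to the second, which costs at most the
factor 2^(−R). -/
theorem two_rpow_split {κ R S : ℝ} (h0 : 0 ≤ κ) (h1 : κ ≤ 1) (hR : 0 ≤ R) (hS : 0 ≤ S) (n : ℕ) :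
    (2 : ℝ) ^ (-R) * (2 : ℝ) ^ (n * (κ * R + (1 - κ) * S))
      ≤ (2 : ℝ) ^ (⌊κ * n⌋₊ * R) * (2 : ℝ) ^ (((n - ⌊κ * n⌋₊ : ℕ) : ℝ) * S) := by
  rw [← Real.rpow_add two_pos, ← Real.rpow_add two_pos, cast_sub_floor_mul h0 h1]
  refine Real.rpow_le_rpow_of_exponent_le one_le_two ?_
  have := floor_mul_le h0 n
  have := Nat.lt_floor_add_one (κ * n)
  nlinarith

end Growth

/-! ### Attainable rates, time sharing and keyed codes -/

section Attainable

open Filter Topology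

variable {X Y Z : Type*} [Fintype Z]

/-- Rate pairs approached, up to constant factors in the numbers of messages, by codes with
arbitrarily small error probability. -/
def Attainable (W : X → Y → Z → ℝ) (R : ℝ × ℝ) : Prop :=
  ∀ ε > 0, ∃ a > 0, ∀ᶠ n : ℕ in atTop, ∃ (M₁ M₂ : Type) (_ : Fintype M₁) (_ : Fintype M₂)
    (c : UCode X Y Z M₁ M₂ n), a * (2 : ℝ) ^ (n * R.1) ≤ Fintype.card M₁ ∧
      a * (2 : ℝ) ^ (n * R.2) ≤ Fintype.card M₂ ∧ c.Reliable W ε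

theorem Achievable.eventually_code {W : X → Y → Z → ℝ} {R : ℝ × ℝ} (hR : Achievable W R)
    [Finite X] [Finite Y] {ε : ℝ} (hε : 0 < ε) :
    ∀ᶠ n : ℕ in atTop, ∃ c : UCode X Y Z (Fin ⌊(2 : ℝ) ^ ((n : ℝ) * R.1)⌋₊)
      (Fin ⌊(2 : ℝ) ^ ((n : ℝ) * R.2)⌋₊) n, c.Reliable W ε := by
  obtain ⟨h1, h2, c, hc⟩ := hR
  filter_upwards [hc.eventually (ge_mem_nhds hε)] with n hn
  exact ⟨_, Code.reliable_of_pe_le (floor_two_rpow_pos (by positivity))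
    (floor_two_rpow_pos (by positivity)) hn⟩

theorem Achievable.attainable [Finite X] [Finite Y] {W : X → Y → Z → ℝ} {R : ℝ × ℝ}
    (hR : Achievable W R) : Attainable W R := by
  intro ε hε
  refine ⟨1 / 2, by norm_num, ?_⟩
  filter_upwards [hR.eventually_code hε] with n ⟨c, hc⟩
  refine ⟨_, _, inferInstance, inferInstance, c, ?_, ?_, hc⟩
  · rw [Fintype.card_fin]
    linarith [half_le_floor (one_le_two_rpow (mul_nonneg (Nat.cast_nonneg n) hR.1))]
  · rw [Fintype.card_fin]
    linarith [half_le_floor (one_le_two_rpow (mul_nonneg (Nat.cast_nonneg n) hR.2.1))]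

theorem achievable_of_eventually [Nonempty X] [Nonempty Y] {W : X → Y → Z → ℝ} (hW : IsMAC W)
    {R : ℝ × ℝ} (h1 : 0 ≤ R.1) (h2 : 0 ≤ R.2)
    (h : ∀ ε > 0, ∀ᶠ n : ℕ in atTop, ∃ c : Code X Y Z ⌊(2 : ℝ) ^ ((n : ℝ) * R.1)⌋₊
      ⌊(2 : ℝ) ^ ((n : ℝ) * R.2)⌋₊ n, c.pe W ≤ ε) : Achievable W R := by
  refine ⟨h1, h2, ?_⟩
  have hne : ∀ n : ℕ, Nonempty (Code X Y Z ⌊(2 : ℝ) ^ ((n : ℝ) * R.1)⌋₊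
      ⌊(2 : ℝ) ^ ((n : ℝ) * R.2)⌋₊ n) := fun n =>
    ⟨⟨fun _ _ => Classical.arbitrary X, fun _ _ => Classical.arbitrary Y,
      fun _ => Output.blameOne⟩⟩
  have hb : ∀ n : ℕ, BddBelow (Set.range fun c : Code X Y Z ⌊(2 : ℝ) ^ ((n : ℝ) * R.1)⌋₊
      ⌊(2 : ℝ) ^ ((n : ℝ) * R.2)⌋₊ n => c.pe W) := fun n =>
    ⟨0, by rintro _ ⟨c, rfl⟩; exact c.pe_nonneg hW⟩
  -- A single sequence must serve all ε, so at each length a code within 1/(n+1) of the infimum of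
  -- the error is taken.
  have hex : ∀ n : ℕ, ∃ c : Code X Y Z ⌊(2 : ℝ) ^ ((n : ℝ) * R.1)⌋₊
      ⌊(2 : ℝ) ^ ((n : ℝ) * R.2)⌋₊ n, ∀ c' : Code X Y Z ⌊(2 : ℝ) ^ ((n : ℝ) * R.1)⌋₊
      ⌊(2 : ℝ) ^ ((n : ℝ) * R.2)⌋₊ n, c.pe W ≤ c'.pe W + 1 / ((n : ℝ) + 1) := fun n => by
    obtain ⟨c, hc⟩ := exists_lt_of_ciInf_lt (lt_add_of_pos_right
      (⨅ c : Code X Y Z ⌊(2 : ℝ) ^ ((n : ℝ) * R.1)⌋₊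
      ⌊(2 : ℝ) ^ ((n : ℝ) * R.2)⌋₊ n, c.pe W) (by positivity : 0 < 1 / ((n : ℝ) + 1)))
    exact ⟨c, fun c' => by linarith [ciInf_le (hb n) c']⟩
  choose c hc using hex
  refine ⟨c, ?_⟩
  refine tendsto_order.2 ⟨fun b hb => Eventually.of_forall fun n => hb.trans_le ((c n).pe_nonneg hW),
    fun b hb => ?_⟩
  filter_upwards [h (b / 2) (by positivity), (tendsto_order.1
    (tendsto_one_div_add_atTop_nhds_zero_nat (𝕜 := ℝ))).2 (b / 2) (by positivity)]
    with n ⟨c', hc'⟩ hn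
  linarith [hc n c']

/-- The strict inequalities below R absorb the constant factor in the code size, and positive rates
make the message sets larger than n², as needed for a subcode good against exponentially many
attacks. -/
theorem Attainable.achievable [Fintype X] [Fintype Y] [Nonempty X] [Nonempty Y]
    {W : X → Y → Z → ℝ} (hW : IsMAC W) {R ρ : ℝ × ℝ} (hR : Attainable W R) (h1 : 0 < ρ.1)
    (h1' : ρ.1 < R.1) (h2 : 0 < ρ.2) (h2' : ρ.2 < R.2) : Achievable W ρ := by
  refine achievable_of_eventually hW h1.le h2.le fun ε hε => ?_
  obtain ⟨a, ha, hc⟩ := hR (ε / 10) (by positivity)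
  have hle : ∀ {s t : ℝ}, s < t →
      ∀ᶠ n : ℕ in atTop, (2 : ℝ) ^ (n * s) ≤ a * (2 : ℝ) ^ (n * t) := fun {s t} hst => by
    have h := (tendsto_pow_mul_two_rpow_neg (sub_pos.2 hst) 0).eventually (ge_mem_nhds ha)
    filter_upwards [h] with n hn
    rw [pow_zero, one_mul] at hn
    calc (2 : ℝ) ^ (n * s) = (2 : ℝ) ^ (-(n * (t - s))) * (2 : ℝ) ^ (n * t) := by
          rw [← Real.rpow_add two_pos]; ring_nf
      _ ≤ _ := mul_le_mul_of_nonneg_right hn (by positivity)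
  filter_upwards [hc, hle h1', hle h2', eventually_sq_le_floor h1 1, eventually_sq_le_floor h2 1,
    eventually_pow_mul_exp_lt_one (Fintype.card X) (by positivity : 0 < ε / 10),
    eventually_pow_mul_exp_lt_one (Fintype.card Y) (by positivity : 0 < ε / 10)]
    with n ⟨M₁, M₂, _, _, c, hM₁, hM₂, hrel⟩ l1 l2 s1 s2 eX eY
  have hsq : ∀ {t : ℝ}, (1 * ((n : ℝ) + 1)) ^ 2 ≤ t → (n : ℝ) ^ 2 ≤ t := fun h => by
    nlinarith [Nat.cast_nonneg (α := ℝ) n]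
  have hfl : ∀ {t : ℝ} {k : ℕ}, 0 ≤ t → t ≤ k → ⌊t⌋₊ ≤ k := fun h0 h =>
    by exact_mod_cast (Nat.floor_le h0).trans h
  obtain ⟨c', hc'⟩ := hrel.exists_code hW (by positivity)
    (floor_two_rpow_pos (by positivity : 0 ≤ n * ρ.1))
    (floor_two_rpow_pos (by positivity : 0 ≤ n * ρ.2))
    (hfl (by positivity) (l1.trans hM₁)) (hfl (by positivity) (l2.trans hM₂))
    (eY _ (hsq s1)) (eX _ (hsq s2))
  exact ⟨c', by linarith⟩

/-- Concatenating a code on a fraction `κ` of the block with a keyed family on the rest. -/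
theorem attainable_of_concat {W : X → Y → Z → ℝ} (hW : IsMAC W) {κ : ℝ} (h0 : 0 ≤ κ) (h1 : κ ≤ 1)
    {R S : ℝ × ℝ} (hR₁ : 0 ≤ R.1) (hR₂ : 0 ≤ R.2) (hS₁ : 0 ≤ S.1) (hS₂ : 0 ≤ S.2)
    (h : ∀ ε > 0, ∃ a > 0, ∃ a' > 0, ∀ᶠ n : ℕ in atTop, ∃ (K₁ K₂ N₁ N₂ : Type) (_ : Fintype K₁)
      (_ : Fintype K₂) (_ : Fintype N₁) (_ : Fintype N₂) (c : UCode X Y Z K₁ K₂ ⌊κ * n⌋₊)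
      (e₁ : K₁ → N₁ → Fin (n - ⌊κ * n⌋₊) → X) (e₂ : K₂ → N₂ → Fin (n - ⌊κ * n⌋₊) → Y)
      (d : K₁ → K₂ → (Fin (n - ⌊κ * n⌋₊) → Z) → Verdict N₁ N₂),
      a * (2 : ℝ) ^ (⌊κ * n⌋₊ * R.1) ≤ Fintype.card K₁ ∧
      a * (2 : ℝ) ^ (⌊κ * n⌋₊ * R.2) ≤ Fintype.card K₂ ∧
      a' * (2 : ℝ) ^ (((n - ⌊κ * n⌋₊ : ℕ) : ℝ) * S.1) ≤ Fintype.card N₁ ∧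
      a' * (2 : ℝ) ^ (((n - ⌊κ * n⌋₊ : ℕ) : ℝ) * S.2) ≤ Fintype.card N₂ ∧
      c.Reliable W ε ∧ KeyedReliable W e₁ e₂ d ε) :
    Attainable W (κ • R + (1 - κ) • S) := by
  intro ε hε
  obtain ⟨a, ha, a', ha', hc⟩ := h (ε / 2) (by positivity)
  -- The power of 2 covers the rounding loss for both coordinates at once.
  refine ⟨a * a' * (2 : ℝ) ^ (-(R.1 + R.2)), by positivity, ?_⟩
  filter_upwards [hc] with n ⟨K₁, K₂, N₁, N₂, _, _, _, _, c, e₁, e₂, d, k1, k2, n1, n2, hrel, hkey⟩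
  have hlen : ⌊κ * n⌋₊ + (n - ⌊κ * n⌋₊) = n := by
    refine Nat.add_sub_of_le ?_
    have : (⌊κ * n⌋₊ : ℝ) ≤ n := (floor_mul_le h0 n).trans
      (by nlinarith [Nat.cast_nonneg (α := ℝ) n])
    exact_mod_cast this
  have hsize : ∀ {ρ σ : ℝ} {K N : ℕ}, 0 ≤ ρ → 0 ≤ σ → ρ ≤ R.1 + R.2 →
      a * (2 : ℝ) ^ (⌊κ * n⌋₊ * ρ) ≤ K →
      a' * (2 : ℝ) ^ (((n - ⌊κ * n⌋₊ : ℕ) : ℝ) * σ) ≤ N →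
      a * a' * (2 : ℝ) ^ (-(R.1 + R.2)) * (2 : ℝ) ^ (n * (κ * ρ + (1 - κ) * σ))
        ≤ ((K * N : ℕ) : ℝ) := fun {ρ σ K N} hρ hσ hle hK hN => by
    calc _ ≤ a * a' * ((2 : ℝ) ^ (-ρ) * (2 : ℝ) ^ (n * (κ * ρ + (1 - κ) * σ))) := by
          rw [mul_assoc]
          refine mul_le_mul_of_nonneg_left (mul_le_mul_of_nonneg_right
            (Real.rpow_le_rpow_of_exponent_le one_le_two (by linarith)) (by positivity))
            (by positivity)
      _ ≤ a * a' * ((2 : ℝ) ^ (⌊κ * n⌋₊ * ρ) * (2 : ℝ) ^ (((n - ⌊κ * n⌋₊ : ℕ) : ℝ) * σ)) :=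
          mul_le_mul_of_nonneg_left (two_rpow_split h0 h1 hρ hσ n) (by positivity)
      _ = (a * (2 : ℝ) ^ (⌊κ * n⌋₊ * ρ)) * (a' * (2 : ℝ) ^ (((n - ⌊κ * n⌋₊ : ℕ) : ℝ) * σ)) := by
          ring
      _ ≤ ((K * N : ℕ) : ℝ) := by
          push_cast
          exact mul_le_mul hK hN (by positivity) (Nat.cast_nonneg K)
  have key : ∃ (M₁ M₂ : Type) (_ : Fintype M₁) (_ : Fintype M₂)
      (c : UCode X Y Z M₁ M₂ (⌊κ * n⌋₊ + (n - ⌊κ * n⌋₊))),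
      a * a' * (2 : ℝ) ^ (-(R.1 + R.2)) * (2 : ℝ) ^ (n * (κ • R + (1 - κ) • S).1)
        ≤ Fintype.card M₁ ∧
      a * a' * (2 : ℝ) ^ (-(R.1 + R.2)) * (2 : ℝ) ^ (n * (κ • R + (1 - κ) • S).2)
        ≤ Fintype.card M₂ ∧ c.Reliable W ε := by
    refine ⟨K₁ × N₁, K₂ × N₂, inferInstance, inferInstance, c.concat e₁ e₂ d, ?_, ?_, ?_⟩
    · rw [Fintype.card_prod]
      exact hsize hR₁ hS₁ (by linarith) k1 n1
    · rw [Fintype.card_prod]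
      exact hsize hR₂ hS₂ (by linarith) k2 n2
    · have := hrel.concat hW hkey
      rwa [add_halves] at this
  rwa [hlen] at key

theorem Attainable.timeShare {W : X → Y → Z → ℝ} (hW : IsMAC W) {κ : ℝ} (h0 : 0 < κ) (h1 : κ < 1)
    {R S : ℝ × ℝ} (hR₁ : 0 ≤ R.1) (hR₂ : 0 ≤ R.2) (hS₁ : 0 ≤ S.1) (hS₂ : 0 ≤ S.2)
    (hR : Attainable W R) (hS : Attainable W S) : Attainable W (κ • R + (1 - κ) • S) := by
  refine attainable_of_concat hW h0.le h1.le hR₁ hR₂ hS₁ hS₂ fun ε hε => ?_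
  obtain ⟨a, ha, hc⟩ := hR ε hε
  obtain ⟨a', ha', hc'⟩ := hS ε hε
  refine ⟨a, ha, a', ha', ?_⟩
  filter_upwards [(tendsto_floor_mul h0).eventually hc,
    (tendsto_sub_floor_mul h0.le h1).eventually hc']
    with n ⟨K₁, K₂, _, _, c, k1, k2, hrel⟩ ⟨N₁, N₂, _, _, c', n1, n2, hrel'⟩
  exact ⟨K₁, K₂, N₁, N₂, _, _, _, _, c, _, _, _, k1, k2, n1, n2, hrel, hrel'.keyed hε.le⟩

/-- The keys are the messages of a code of rates r on the prefix. They exceed the square of the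
remaining length because their number grows exponentially, and `hκ` keeps the number of keys of user
1 below the exponential bound under which the keyed family exists. -/
theorem Achievable.attainable_of_keyed [Finite X] [Finite Y] {W : X → Y → Z → ℝ} (hW : IsMAC W)
    {r S : ℝ × ℝ} (hr : Achievable W r) (hr₁ : 0 < r.1) (hr₂ : 0 < r.2) (hS₁ : 0 ≤ S.1)
    (hS₂ : 0 ≤ S.2) {γ : ℝ} (hγ : 0 < γ)
    (h : ∀ ε > 0, ∀ᶠ n : ℕ in atTop, ∀ K₁ K₂ : ℕ, (n : ℝ) ^ 2 ≤ K₁ → (n : ℝ) ^ 2 ≤ K₂ →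
      (K₁ : ℝ) ≤ (2 : ℝ) ^ (n * γ) → ∃ (N₁ N₂ : ℕ) (e₁ : Fin K₁ → Fin N₁ → Fin n → X)
        (e₂ : Fin K₂ → Fin N₂ → Fin n → Y)
        (d : Fin K₁ → Fin K₂ → (Fin n → Z) → Verdict (Fin N₁) (Fin N₂)),
        (2 : ℝ) ^ (n * S.1) ≤ N₁ ∧ (2 : ℝ) ^ (n * S.2) ≤ N₂ ∧ KeyedReliable W e₁ e₂ d ε)
    {κ : ℝ} (h0 : 0 < κ) (h1 : κ < 1) (hκ : κ * r.1 ≤ (1 - κ) * γ) :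
    Attainable W (κ • r + (1 - κ) • S) := by
  refine attainable_of_concat hW h0.le h1.le hr₁.le hr₂.le hS₁ hS₂ fun ε hε => ?_
  refine ⟨1 / 2, by norm_num, 1, one_pos, ?_⟩
  filter_upwards [(tendsto_floor_mul h0).eventually (hr.eventually_code hε),
    (tendsto_floor_mul h0).eventually (eventually_sq_le_floor hr₁ (1 / κ)),
    (tendsto_floor_mul h0).eventually (eventually_sq_le_floor hr₂ (1 / κ)),
    (tendsto_sub_floor_mul h0.le h1).eventually (h ε hε)]
    with n ⟨c, hc⟩ s1 s2 hn
  have hsub := cast_sub_floor_mul h0.le h1.le n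
  have hfl := floor_mul_le h0.le n
  -- The length of the remaining part is at most n, hence at most 1/κ times the prefix length plus
  -- one; this explains the constant 1/κ above.
  have hsq : ((n - ⌊κ * n⌋₊ : ℕ) : ℝ) ^ 2 ≤ (1 / κ * ((⌊κ * n⌋₊ : ℝ) + 1)) ^ 2 := by
    refine pow_le_pow_left₀ (Nat.cast_nonneg _) ?_ 2
    rw [hsub, one_div, ← div_eq_inv_mul, le_div_iff₀ h0]
    nlinarith [Nat.lt_floor_add_one (κ * n), Nat.cast_nonneg (α := ℝ) ⌊κ * n⌋₊]
  obtain ⟨N₁, N₂, e₁, e₂, d, n1, n2, hd⟩ := hn _ _ (hsq.trans s1) (hsq.trans s2) (by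
    refine (Nat.floor_le (by positivity)).trans
      (Real.rpow_le_rpow_of_exponent_le one_le_two ?_)
    rw [hsub]
    nlinarith [mul_le_mul_of_nonneg_left hκ (Nat.cast_nonneg (α := ℝ) n)])
  refine ⟨_, _, _, _, inferInstance, inferInstance, inferInstance, inferInstance, c, e₁, e₂, d,
    ?_, ?_, ?_, ?_, hc, hd⟩
  · rw [Fintype.card_fin, one_div_mul_eq_div]
    exact half_le_floor (one_le_two_rpow (by positivity))
  · rw [Fintype.card_fin, one_div_mul_eq_div]
    exact half_le_floor (one_le_two_rpow (by positivity))
  · rwa [Fintype.card_fin, one_mul]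
  · rwa [Fintype.card_fin, one_mul]

end Attainable

/-! ### Convexity of the capacity region -/

section CapacityRegion

open Filter Topology

variable {X Y Z : Type*} [Fintype Z]

theorem capacityRegion_subset (W : X → Y → Z → ℝ) :
    capacityRegion W ⊆ {R | 0 ≤ R.1 ∧ 0 ≤ R.2} :=
  closure_minimal (fun _ hR => ⟨hR.1, hR.2.1⟩)
    ((isClosed_le continuous_const continuous_fst).inter
      (isClosed_le continuous_const continuous_snd))

/-- An interior point can be pushed along the diagonal to make both coordinates positive, and
achievable pairs are dense near it. -/
theorem exists_achievable_pos {W : X → Y → Z → ℝ} (hC : (interior (capacityRegion W)).Nonempty) :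
    ∃ r, Achievable W r ∧ 0 < r.1 ∧ 0 < r.2 := by
  obtain ⟨u, hu⟩ := hC
  have hnn := capacityRegion_subset W (interior_subset hu)
  have ht : Tendsto (fun t : ℝ => u + (t, t)) (𝓝[>] 0) (𝓝 u) := by
    have : Continuous fun t : ℝ => u + (t, t) := by fun_prop
    simpa [← Prod.zero_eq_mk] using this.continuousWithinAt (s := Set.Ioi 0) (x := 0).tendsto
  obtain ⟨t, ht, ht0⟩ := ((ht.eventually (isOpen_interior.mem_nhds hu)).and
    self_mem_nhdsWithin).exists
  have hopen : IsOpen (interior (capacityRegion W) ∩ {R : ℝ × ℝ | 0 < R.1 ∧ 0 < R.2}) :=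
    isOpen_interior.inter ((isOpen_lt continuous_const continuous_fst).inter
      (isOpen_lt continuous_const continuous_snd))
  have ht0' : 0 < t := ht0
  obtain ⟨r, ⟨-, hr⟩, hrA⟩ := mem_closure_iff.1 (interior_subset ht : u + (t, t) ∈ capacityRegion W)
    _ hopen ⟨ht, add_pos_of_nonneg_of_pos hnn.1 ht0', add_pos_of_nonneg_of_pos hnn.2 ht0'⟩
  exact ⟨r, hrA, hr.1, hr.2⟩

theorem Achievable.nonempty {W : X → Y → Z → ℝ} {R : ℝ × ℝ} (hR : Achievable W R) :
    Nonempty X ∧ Nonempty Y := by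
  obtain ⟨h1, h2, c, -⟩ := hR
  exact ⟨⟨(c 1).enc₁ ⟨0, floor_two_rpow_pos (by positivity)⟩ 0⟩,
    ⟨(c 1).enc₂ ⟨0, floor_two_rpow_pos (by positivity)⟩ 0⟩⟩

variable [Fintype X] [Fintype Y] {W : X → Y → Z → ℝ} (hW : IsMAC W) {r : ℝ × ℝ} (hr : Achievable W r) (hr₁ : 0 < r.1)
  (hr₂ : 0 < r.2)

include hW hr hr₁ hr₂

/-- R may lie on an axis, where subcodes would be too small. Mixing with a little of r makes both
rates positive, and scaling by 1 − t gives the strict inequality required for achievability. -/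
theorem Attainable.mem_capacityRegion {R : ℝ × ℝ} (hR : Attainable W R) (h1 : 0 ≤ R.1)
    (h2 : 0 ≤ R.2) : R ∈ capacityRegion W := by
  obtain ⟨_, _⟩ := hr.nonempty
  have ht : Tendsto (fun t : ℝ => (1 - t) • (t • r + (1 - t) • R)) (𝓝[>] 0) (𝓝 R) := by
    have : Continuous fun t : ℝ => (1 - t) • (t • r + (1 - t) • R) := by fun_prop
    simpa using this.continuousWithinAt (s := Set.Ioi 0) (x := 0).tendsto
  refine mem_closure_of_tendsto ht ?_
  filter_upwards [Ioo_mem_nhdsGT (zero_lt_one (α := ℝ))] with t ⟨t0, t1⟩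
  have t1' : 0 < 1 - t := by linarith
  have p1 : 0 < t * r.1 + (1 - t) * R.1 := by positivity
  have p2 : 0 < t * r.2 + (1 - t) * R.2 := by positivity
  refine (Attainable.timeShare hW t0 t1 hr₁.le hr₂.le h1 h2 hr.attainable hR).achievable hW
    ?_ ?_ ?_ ?_
  · exact mul_pos t1' p1
  · change (1 - t) * (t * r.1 + (1 - t) * R.1) < t * r.1 + (1 - t) * R.1
    nlinarith
  · exact mul_pos t1' p2
  · change (1 - t) * (t * r.2 + (1 - t) * R.2) < t * r.2 + (1 - t) * R.2
    nlinarith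

theorem convex_capacityRegion : Convex ℝ (capacityRegion W) := by
  have hA : Convex ℝ {R | Attainable W R ∧ 0 ≤ R.1 ∧ 0 ≤ R.2} := by
    rintro R ⟨hR, hR₁, hR₂⟩ S ⟨hS, hS₁, hS₂⟩ a b ha hb hab
    obtain rfl : b = 1 - a := by linarith
    refine ⟨?_, add_nonneg (mul_nonneg ha hR₁) (mul_nonneg hb hS₁),
      add_nonneg (mul_nonneg ha hR₂) (mul_nonneg hb hS₂)⟩
    rcases ha.eq_or_lt with rfl | ha'
    · simpa using hS
    rcases hb.eq_or_lt with hb' | hb'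
    · obtain rfl : a = 1 := by linarith
      simpa using hR
    · exact Attainable.timeShare hW ha' (by linarith) hR₁ hR₂ hS₁ hS₂ hR hS
  have heq : capacityRegion W = closure {R | Attainable W R ∧ 0 ≤ R.1 ∧ 0 ≤ R.2} := by
    refine Set.Subset.antisymm (closure_mono fun R hR => ⟨hR.attainable, hR.1, hR.2.1⟩)
      (closure_minimal (fun R hR => ?_) isClosed_closure)
    exact hR.1.mem_capacityRegion hW hr hr₁ hr₂ hR.2.1 hR.2.2
  rw [heq]
  exact hA.closure

end CapacityRegion

/-! ### The decision rule -/

section Decision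

variable {M₁ M₂ : Type*}

/-- The decision rule: `A₁` and `A₂` are the candidate messages of the users and `I` tells which
pairs of candidates are compatible. -/
def decideVerdict (A₁ : M₁ → Prop) (A₂ : M₂ → Prop) (I : M₁ → M₂ → Prop) : Verdict M₁ M₂ :=
  if ∃ m₂, A₂ m₂ then
    if h₁ : ∃! m₁, A₁ m₁ then
      if h₂ : ∃! m₂, A₂ m₂ ∧ I h₁.choose m₂ then pair h₁.choose h₂.choose else two
    else one
  else two

/-- With the true message of user 1 among the candidates, the rule blames user 1 only if user 2 has
a candidate and user 1 has a second one. -/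
theorem badTwo_decideVerdict {A₁ : M₁ → Prop} {A₂ : M₂ → Prop} {I : M₁ → M₂ → Prop} {m : M₁}
    (h : BadTwo m (decideVerdict A₁ A₂ I)) :
    ¬ A₁ m ∨ ∃ m', m' ≠ m ∧ A₁ m' ∧ ∃ m₂, A₂ m₂ := by
  by_contra! hc
  obtain ⟨hm, hu⟩ := hc
  refine h ?_
  rw [decideVerdict]
  by_cases h2 : ∃ m₂, A₂ m₂
  · have h1 : ∃! m₁, A₁ m₁ := ⟨m, hm, fun m' hm' => by
      by_contra hne
      obtain ⟨m₂, hm₂⟩ := h2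
      exact hu m' hne hm' m₂ hm₂⟩
    have hm1 : h1.choose = m := h1.unique h1.choose_spec.1 hm
    rw [if_pos h2, dif_pos h1]
    split_ifs with h3
    · exact Or.inl ⟨h3.choose, congrArg (fun a => pair a h3.choose) hm1⟩
    · exact Or.inr rfl
  · rw [if_neg h2]
    exact Or.inr rfl

/-- A true candidate of user 2 prevents the first blame of user 2, and several or no candidates of
user 1 rightly lead to blaming user 1. What remains is a unique m₁ that is incompatible with the
true message or compatible with a second candidate. -/
theorem badOne_decideVerdict {A₁ : M₁ → Prop} {A₂ : M₂ → Prop} {I : M₁ → M₂ → Prop} {m : M₂}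
    (h : BadOne m (decideVerdict A₁ A₂ I)) :
    ¬ A₂ m ∨ ∃ m₁, (∀ m', A₁ m' ↔ m' = m₁) ∧
      (¬ I m₁ m ∨ ∃ m', m' ≠ m ∧ A₂ m' ∧ I m₁ m') := by
  by_contra! hc
  obtain ⟨hm, hu⟩ := hc
  refine h ?_
  rw [decideVerdict, if_pos ⟨m, hm⟩]
  by_cases h1 : ∃! m₁, A₁ m₁
  · obtain ⟨hI, hI'⟩ := hu h1.choose fun m' =>
      ⟨fun hm' => h1.unique hm' h1.choose_spec.1, fun hm' => hm' ▸ h1.choose_spec.1⟩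
    have h2 : ∃! m₂, A₂ m₂ ∧ I h1.choose m₂ := ⟨m, ⟨hm, hI⟩, fun m' hm' => by
      by_contra hne
      exact hI' m' hne hm'.1 hm'.2⟩
    rw [dif_pos h1, dif_pos h2, h2.unique h2.choose_spec.1 ⟨hm, hI⟩]
    exact Or.inl ⟨_, rfl⟩
  · rw [dif_neg h1]
    exact Or.inr rfl

end Decision

/-! ### Averaging over random codebooks -/

section RandomCodebook

variable {A C : Type*} [Fintype A] [Fintype C]

/-- The probability that the output for the codeword `m` is bad, or is hit by another codeword,
on average over memoryless codebooks. -/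
theorem avg_prob_confusion_le {p : A → ℝ} (hp : p ∈ stdSimplex ℝ A) {V : A → C → ℝ}
    (hV : ∀ a, V a ∈ stdSimplex ℝ C) {N : ℕ} (m : Fin N) {B F : A → C → Prop} {τ q : ℝ}
    (hB : avg p (fun a => prob (V a) (B a)) ≤ τ) (hF : ∀ z, prob p (fun a => F a z) ≤ q) :
    avg (piW fun _ : Fin N => p) (fun c => prob (V (c m)) fun z =>
      B (c m) z ∨ ∃ m', m' ≠ m ∧ F (c m') z) ≤ τ + ((N : ℝ) - 1) * q := by
  have hP := piW_mem fun _ : Fin N => hp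
  have h1 : ∀ c : Fin N → A, prob (V (c m)) (fun z => B (c m) z ∨ ∃ m', m' ≠ m ∧ F (c m') z)
      ≤ prob (V (c m)) (B (c m)) + ∑ m' ∈ univ.erase m, prob (V (c m)) (F (c m')) := fun c => by
    refine (prob_or_le (hV _) _ _).trans (add_le_add_right ?_ _)
    refine le_trans (prob_mono (hV _) fun z hz => ?_) (prob_exists_le (hV _) _ _)
    obtain ⟨m', hne, hm'⟩ := hz
    exact ⟨m', mem_erase.2 ⟨hne, mem_univ _⟩, hm'⟩
  refine (avg_mono hP h1).trans ?_
  rw [avg_add, avg_sum]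
  refine add_le_add ?_ ?_
  · rw [avg_piW_apply (fun _ => hp) m fun a => prob (V a) (B a)]
    exact hB
  · have h2 : ∀ m' ∈ univ.erase m,
        avg (piW fun _ : Fin N => p) (fun c => prob (V (c m)) (F (c m'))) ≤ q := by
      intro m' hm'
      have hne : m ≠ m' := (ne_of_mem_erase hm').symm
      -- The competing codeword can be redrawn independently of the transmitted one, and hence of
      -- the output.
      rw [avg_piW_update m' hp]
      simp only [Function.update_self, Function.update_of_ne hne]
      refine avg_le_const hP fun c => ?_
      simp only [prob]
      rw [avg_comm]
      exact avg_le_const (hV _) hF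
    refine (sum_le_card_nsmul _ _ q h2).trans (le_of_eq ?_)
    rw [nsmul_eq_mul, card_erase_of_mem (mem_univ m), card_univ, Fintype.card_fin,
      Nat.cast_sub m.pos, Nat.cast_one]

/-- Conditioning on an event of probability at least 1/2 enforces it and at most doubles nonnegative
expectations. -/
theorem exists_conditioned {p : A → ℝ} (hp : p ∈ stdSimplex ℝ A) {G : A → Prop}
    (hG : prob p (fun a => ¬ G a) ≤ 1 / 2) :
    ∃ p' ∈ stdSimplex ℝ A, (∀ a, p' a ≠ 0 → G a) ∧
      ∀ f : A → ℝ, (∀ a, 0 ≤ f a) → avg p' f ≤ 2 * avg p f := by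
  have hs : prob p G + prob p (fun a => ¬ G a) = 1 := by
    refine Eq.trans ?_ (avg_const hp 1)
    rw [prob, prob, ← avg_add]
    congr 1
    funext a
    by_cases h : G a <;> simp [h]
  have hG' : 1 / 2 ≤ prob p G := by linarith
  have hpos : 0 < prob p G := by linarith
  refine ⟨fun a => p a * (if G a then 1 else 0) / prob p G, ⟨fun a => ?_, ?_⟩, fun a ha => ?_,
    fun f hf => ?_⟩
  · exact div_nonneg (mul_nonneg (hp.1 a) (by split_ifs <;> norm_num)) hpos.le
  · rw [← sum_div]
    exact div_self hpos.ne'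
  · by_contra h
    simp [h] at ha
  · rw [avg, avg, mul_sum]
    refine sum_le_sum fun a _ => ?_
    have h0 := mul_nonneg (hp.1 a) (hf a)
    split_ifs
    · rw [mul_one, div_mul_eq_mul_div, div_le_iff₀ hpos]
      nlinarith
    · simpa using h0

end RandomCodebook

/-! ### Choosing codebooks for all keys -/

section KeyedCodebooks

variable {X Y Z : Type*} [Fintype X] [Fintype Y] [Fintype Z] {n : ℕ} {W : X → Y → Z → ℝ}

/-- The average probability, over the messages of user 1, of the events that may lead to an
error when user 2 inputs `y`. -/
def confusionTwo (W : X → Y → Z → ℝ) (E F : (Fin n → X) → (Fin n → Z) → Prop) {N : ℕ}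
    (y : Fin n → Y) (c : Fin N → Fin n → X) : ℝ :=
  (∑ m, outProb W (c m) y fun z => ¬ E (c m) z ∨ ∃ m', m' ≠ m ∧ F (c m') z) / N

/-- The average probability, over the messages of user 2, of the events that may lead to an
error when user 1 inputs `x` and uses the codebook `c`. -/
def confusionOne (W : X → Y → Z → ℝ) (E : (Fin n → X) → (Fin n → Z) → Prop)
    (E' : (Fin n → Y) → (Fin n → Z) → Prop) (I : (Fin n → X) → (Fin n → Y) → Prop)
    (F : (Fin n → X) → (Fin n → Z) → Prop)
    (F' : (Fin n → Y) → (Fin n → X) → (Fin n → Z) → Prop) {N N' : ℕ}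
    (x : Fin n → X) (c : Fin N → Fin n → X) (c' : Fin N' → Fin n → Y) : ℝ :=
  (∑ m, outProb W x (c' m) fun z =>
    (¬ E' (c' m) z ∨ ∃ m₁, ¬ I (c m₁) (c' m) ∧ F (c m₁) z) ∨
      ∃ m', m' ≠ m ∧ ∃ m₁, (∀ m, E (c m) z ↔ m = m₁) ∧ F' (c' m') (c m₁) z) / N'

/-- The probability that an honest codeword of user 2 is incompatible with `x'` while the output
is confusable with `x'`, when user 1 inputs `x`. -/
def correlation (W : X → Y → Z → ℝ) (P₂ : Y → ℝ) (I : (Fin n → X) → (Fin n → Y) → Prop)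
    (F : (Fin n → X) → (Fin n → Z) → Prop) (x x' : Fin n → X) : ℝ :=
  avg (piW fun _ => P₂) fun y => outProb W x y fun z => ¬ I x' y ∧ F x' z

variable {P₁ : X → ℝ} {P₂ : Y → ℝ} {E F : (Fin n → X) → (Fin n → Z) → Prop}
  {E' : (Fin n → Y) → (Fin n → Z) → Prop} {I : (Fin n → X) → (Fin n → Y) → Prop}
  {F' : (Fin n → Y) → (Fin n → X) → (Fin n → Z) → Prop} {N N' : ℕ}

theorem sum_div_nonneg_le_one {f : Fin N → ℝ} (h0 : ∀ m, 0 ≤ f m) (h1 : ∀ m, f m ≤ 1) :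
    0 ≤ (∑ m, f m) / N ∧ (∑ m, f m) / N ≤ 1 := by
  refine ⟨div_nonneg (sum_nonneg fun m _ => h0 m) (Nat.cast_nonneg N), ?_⟩
  refine div_le_one_of_le₀ ?_ (Nat.cast_nonneg N)
  refine (sum_le_card_nsmul _ _ 1 fun m _ => h1 m).trans ?_
  simp

theorem avg_sum_div_le {A : Type*} [Fintype A] {w : A → ℝ} {f : A → Fin N → ℝ} {r : ℝ}
    (hN : 0 < N) (h : ∀ m, avg w (fun a => f a m) ≤ r) :
    avg w (fun a => (∑ m, f a m) / N) ≤ r := by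
  have hN' : (0 : ℝ) < N := by exact_mod_cast hN
  simp only [div_eq_inv_mul]
  rw [avg_const_mul, avg_sum, inv_mul_le_iff₀ hN']
  refine (sum_le_card_nsmul _ _ r fun m _ => h m).trans ?_
  simp

/-- Two demands are made on the codebooks of user 1. The sum of correlations must be small for every
x in every single codebook: for one x a Chernoff bound applies, and a random codebook satisfies the
demand with probability at least 1/2. The confusion under attacks of user 2 need only be small on
average over keys, and is treated by Chernoff under the conditioned law. -/
theorem exists_codebooks_one (hW : IsMAC W) (hP₁ : P₁ ∈ stdSimplex ℝ X)
    (hP₂ : P₂ ∈ stdSimplex ℝ Y) (hN : 0 < N) {e q : ℝ} (he : 0 < e)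
    (hE : ∀ y, avg (piW fun _ => P₁) (fun x => outProb W x y fun z => ¬ E x z) ≤ e)
    (hF : ∀ z, prob (piW fun _ => P₁) (fun x => F x z) ≤ q)
    (hI : ∀ x, prob (piW fun _ => P₂) (fun y => ¬ I x y) ≤ e) (hq : ((N : ℝ) - 1) * q ≤ e)
    {t : ℝ} (ht : (Fintype.card X : ℝ) ^ n * Real.exp (4 - t) ≤ 1 / 2) {K : ℕ} {ε : ℝ}
    (hK : (Fintype.card Y : ℝ) ^ n * Real.exp (2 * (K * (4 * e)) - K * ε) < 1) :
    ∃ c : Fin K → Fin N → Fin n → X,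
      (∀ k x, ∑ m, correlation W P₂ I F x (c k m) ≤ t * e) ∧
      ∀ y, ∑ k, confusionTwo W E F y (c k) ≤ K * ε := by
  have hp₁ := piW_mem fun _ : Fin n => hP₁
  have hp₂ := piW_mem fun _ : Fin n => hP₂
  have hcode := piW_mem fun _ : Fin N => hp₁
  have hc0 : ∀ x x', 0 ≤ correlation W P₂ I F x x' := fun x x' =>
    avg_nonneg hp₂ fun y => prob_nonneg (piW_channel_mem hW _ _) _
  have hce : ∀ x x', correlation W P₂ I F x x' ≤ e := fun x x' => by
    refine le_trans (avg_mono hp₂ fun y => ?_) (hI x')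
    by_cases h : I x' y
    · simp [h, outProb, prob, avg]
    · simpa [h, outProb] using prob_le_one (piW_channel_mem hW _ _) _
  have hcq : ∀ x, avg (piW fun _ => P₁) (correlation W P₂ I F x) ≤ q := fun x => by
    change avg _ (fun x' => avg _ fun y => outProb W x y fun z => ¬ I x' y ∧ F x' z) ≤ q
    rw [avg_comm]
    refine avg_le_const hp₂ fun y => ?_
    simp only [outProb, prob]
    rw [avg_comm]
    refine avg_le_const (piW_channel_mem hW _ _) fun z => le_trans ?_ (hF z)
    exact prob_mono hp₁ fun x' h => h.2
  have hgood : prob (piW fun _ : Fin N => piW fun _ => P₁)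
      (fun c => ¬ ∀ x, ∑ m, correlation W P₂ I F x (c m) ≤ t * e) ≤ 1 / 2 := by
    refine le_trans (prob_mono hcode fun c hc => ?_)
      ((prob_exists_le hcode (univ : Finset (Fin n → X))
        fun x c => t ≤ ∑ m, correlation W P₂ I F x (c m) / e).trans (le_trans ?_ ht))
    · push Not at hc
      obtain ⟨x, hx⟩ := hc
      refine ⟨x, mem_univ x, ?_⟩
      rw [← sum_div, le_div_iff₀ he]
      exact hx.le
    · refine (sum_le_card_nsmul _ _ (Real.exp (4 - t)) fun x _ => ?_).trans (by simp)
      refine (prob_sum_ge_le (g := fun (_ : Fin N) x' => correlation W P₂ I F x x' / e)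
        (fun _ => hp₁) (fun m x' => div_nonneg (hc0 _ _) he.le)
        (fun m x' => (div_le_one he).2 (hce _ _)) t).trans (Real.exp_le_exp.2 ?_)
      simp only [div_eq_inv_mul, avg_const_mul]
      rw [sum_const, card_univ, Fintype.card_fin, nsmul_eq_mul]
      set u := avg (piW fun _ => P₁) (correlation W P₂ I F x)
      have h1 : u ≤ e := avg_le_const hp₁ (hce x)
      have hN1 : (1 : ℝ) ≤ N := by exact_mod_cast hN
      have h2 : ((N : ℝ) - 1) * u ≤ e :=
        (mul_le_mul_of_nonneg_left (hcq x) (by linarith)).trans hq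
      -- Of the N codewords, N−1 contribute at most e in total by `hq`, and the last one at most e
      -- since incompatibility alone has probability at most e. Twice this mean gives the 4 in exp(4
      -- − t).
      have h3 : (N : ℝ) * (e⁻¹ * u) ≤ 2 := by
        rw [mul_left_comm, inv_mul_le_iff₀ he]
        linarith
      linarith
  obtain ⟨p', hp', hpG, hpf⟩ := exists_conditioned hcode hgood
  have hb : ∀ y (c : Fin N → Fin n → X), 0 ≤ confusionTwo W E F y c ∧ confusionTwo W E F y c ≤ 1 :=
    fun y c => sum_div_nonneg_le_one (fun m => prob_nonneg (piW_channel_mem hW _ _) _)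
      fun m => prob_le_one (piW_channel_mem hW _ _) _
  -- The mean per key is at most e + e, doubled by the conditioning: hence 4e.
  obtain ⟨c, hc, hs⟩ := exists_forall_sum_lt (ι := Fin K) (w := fun _ => p')
    (g := fun y (_ : Fin K) c => confusionTwo W E F y c) (μ := K * (4 * e)) (t := K * ε)
    (fun _ => hp') (fun y _ c => (hb y c).1) (fun y _ c => (hb y c).2) (fun y => by
      rw [sum_const, card_univ, Fintype.card_fin, nsmul_eq_mul]
      refine mul_le_mul_of_nonneg_left ?_ (Nat.cast_nonneg K)
      refine (hpf _ fun c => (hb y c).1).trans ?_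
      have : avg (piW fun _ : Fin N => piW fun _ => P₁) (confusionTwo W E F y) ≤ e + e := by
        refine avg_sum_div_le hN fun m => ?_
        refine (avg_prob_confusion_le hp₁ (V := fun x => piW fun t => W (x t) (y t))
          (fun x => piW_channel_mem hW x y) m (B := fun x z => ¬ E x z) (hE y) hF).trans ?_
        linarith
      linarith) (by simpa using hK)
  exact ⟨c, fun k => hpG _ (hc k), fun y => (hs y).le⟩

/-- The codebooks of user 1 are fixed first. An adversarial user 1 is free to select its key, so the
confusion is summed over all K keys; this costs a factor K in the mean but yields a bound
independent of the key. -/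
theorem exists_codebooks_two (hW : IsMAC W) (hP₂ : P₂ ∈ stdSimplex ℝ Y) (hN' : 0 < N') {e q t : ℝ}
    (hE' : ∀ x, avg (piW fun _ => P₂) (fun y => outProb W x y fun z => ¬ E' y z) ≤ e)
    (hF' : ∀ x z, prob (piW fun _ => P₂) (fun y => F' y x z) ≤ q) (hq0 : 0 ≤ q)
    (hq : ((N' : ℝ) - 1) * q ≤ e) {K K' : ℕ} {c : Fin K → Fin N → Fin n → X}
    (hc : ∀ k x, ∑ m, correlation W P₂ I F x (c k m) ≤ t * e) {ε : ℝ}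
    (hK : (Fintype.card X : ℝ) ^ n * Real.exp (2 * (K' * (K * ((t + 2) * e))) - K' * ε) < 1) :
    ∃ c' : Fin K' → Fin N' → Fin n → Y, ∀ x, ∃ G : Fin K' → ℝ, (∀ k, 0 ≤ G k) ∧
      (∑ k, G k ≤ K' * ε) ∧ ∀ k k', confusionOne W E E' I F F' x (c k) (c' k') ≤ G k' := by
  have hp₂ := piW_mem fun _ : Fin n => hP₂
  have hcode := piW_mem fun _ : Fin N' => hp₂
  have hb : ∀ x (c : Fin N → Fin n → X) (c' : Fin N' → Fin n → Y),
      0 ≤ confusionOne W E E' I F F' x c c' ∧ confusionOne W E E' I F F' x c c' ≤ 1 :=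
    fun x c c' => sum_div_nonneg_le_one (fun m => prob_nonneg (piW_channel_mem hW _ _) _)
      fun m => prob_le_one (piW_channel_mem hW _ _) _
  have havg : ∀ x k, avg (piW fun _ : Fin N' => piW fun _ => P₂)
      (confusionOne W E E' I F F' x (c k)) ≤ (t + 2) * e := by
    intro x k
    refine avg_sum_div_le hN' fun m => ?_
    have h1 : avg (piW fun _ => P₂) (fun y => prob (piW fun t => W (x t) (y t)) fun z =>
        ¬ E' y z ∨ ∃ m₁, ¬ I (c k m₁) y ∧ F (c k m₁) z) ≤ e + t * e := by
      refine le_trans (avg_mono hp₂ fun y => prob_or_le (piW_channel_mem hW x y) _ _) ?_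
      rw [avg_add]
      refine add_le_add (hE' x) (le_trans ?_ (hc k x))
      simp only [correlation]
      rw [← avg_sum]
      refine avg_mono hp₂ fun y => le_trans (prob_mono (piW_channel_mem hW x y) fun z hz => ?_)
        (prob_exists_le (piW_channel_mem hW x y) univ _)
      obtain ⟨m₁, hm₁⟩ := hz
      exact ⟨m₁, mem_univ _, hm₁⟩
    have h2 : ∀ z, prob (piW fun _ => P₂) (fun y : Fin n → Y =>
        ∃ m₁, (∀ m, E (c k m) z ↔ m = m₁) ∧ F' y (c k m₁) z) ≤ q := by
      intro z
      -- The unique candidate of user 1 is determined by z and the fixed codebook, so there is no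
      -- union over m₁ and the rate of user 1 does not enter the bound for R₂.
      by_cases h : ∃ m₁, ∀ m, E (c k m) z ↔ m = m₁
      · obtain ⟨m₁, hm₁⟩ := h
        refine (prob_mono hp₂ fun y hy => ?_).trans (hF' (c k m₁) z)
        obtain ⟨m₁', hm₁', hy⟩ := hy
        obtain rfl : m₁ = m₁' := (hm₁' m₁).1 ((hm₁ m₁).2 rfl)
        exact hy
      · refine (avg_le_const hp₂ fun y => ?_).trans hq0
        rw [if_neg fun ⟨m₁, h', _⟩ => h ⟨m₁, h'⟩]
    refine (avg_prob_confusion_le hp₂ (V := fun y => piW fun t => W (x t) (y t))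
      (fun y => piW_channel_mem hW x y) m h1 h2).trans ?_
    linarith
  obtain ⟨c', -, hs⟩ := exists_forall_sum_lt (ι := Fin K')
    (w := fun _ => piW fun _ : Fin N' => piW fun _ => P₂)
    -- Truncation at 1 gives the bounded variables required by Chernoff and still dominates the
    -- confusion of each key, which is at most 1.
    (g := fun x (_ : Fin K') c' => min 1 (∑ k, confusionOne W E E' I F F' x (c k) c'))
    (μ := K' * (K * ((t + 2) * e))) (t := K' * ε) (fun _ => hcode)
    (fun x _ c' => le_min zero_le_one (sum_nonneg fun k _ => (hb _ _ _).1))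
    (fun x _ c' => min_le_left _ _) (fun x => by
      rw [sum_const, card_univ, Fintype.card_fin, nsmul_eq_mul]
      refine mul_le_mul_of_nonneg_left ?_ (Nat.cast_nonneg K')
      refine (avg_mono hcode fun c' => min_le_right _ _).trans ?_
      rw [avg_sum]
      refine (sum_le_card_nsmul _ _ _ fun k _ => havg x k).trans ?_
      simp) (by simpa using hK)
  refine ⟨c', fun x => ⟨_, fun k => le_min zero_le_one (sum_nonneg fun _ _ => (hb _ _ _).1),
    (hs x).le, fun k k' => le_min (hb _ _ _).2 ?_⟩⟩
  exact single_le_sum (f := fun k => confusionOne W E E' I F F' x (c k) (c' k'))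
    (fun k _ => (hb _ _ _).1) (mem_univ k)

/-- The decoder of the random code. -/
def candidateDec (E : (Fin n → X) → (Fin n → Z) → Prop) (E' : (Fin n → Y) → (Fin n → Z) → Prop)
    (I : (Fin n → X) → (Fin n → Y) → Prop) (c : Fin N → Fin n → X) (c' : Fin N' → Fin n → Y)
    (z : Fin n → Z) : Verdict (Fin N) (Fin N') :=
  decideVerdict (fun m => E (c m) z) (fun m => E' (c' m) z) fun m m' => I (c m) (c' m')

/-- The decoder's errors are stated through candidates; `hsep` turns the coincidence of candidates
of both users into the events `F` and `F'`, each a condition on a codeword whose probability is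
controlled. The error under attacks of user 2 does not involve the codebooks of user 2, so user 1's
can be chosen first. -/
theorem exists_keyedReliable (hW : IsMAC W) (hP₁ : P₁ ∈ stdSimplex ℝ X)
    (hP₂ : P₂ ∈ stdSimplex ℝ Y)
    (hsep : ∀ x y z, E x z → E' y z → F x z ∧ (I x y → F' y x z))
    (hN : 0 < N) (hN' : 0 < N') {e q q' t ε : ℝ} (he : 0 < e)
    (hE : ∀ y, avg (piW fun _ => P₁) (fun x => outProb W x y fun z => ¬ E x z) ≤ e)
    (hE' : ∀ x, avg (piW fun _ => P₂) (fun y => outProb W x y fun z => ¬ E' y z) ≤ e)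
    (hI : ∀ x, prob (piW fun _ => P₂) (fun y => ¬ I x y) ≤ e)
    (hF : ∀ z, prob (piW fun _ => P₁) (fun x => F x z) ≤ q)
    (hF' : ∀ x z, prob (piW fun _ => P₂) (fun y => F' y x z) ≤ q') (hq0 : 0 ≤ q')
    (hq : ((N : ℝ) - 1) * q ≤ e) (hq' : ((N' : ℝ) - 1) * q' ≤ e)
    (ht : (Fintype.card X : ℝ) ^ n * Real.exp (4 - t) ≤ 1 / 2) {K K' : ℕ}
    (hK : (Fintype.card Y : ℝ) ^ n * Real.exp (2 * (K * (4 * e)) - K * ε) < 1)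
    (hK' : (Fintype.card X : ℝ) ^ n * Real.exp (2 * (K' * (K * ((t + 2) * e))) - K' * ε) < 1) :
    ∃ (c : Fin K → Fin N → Fin n → X) (c' : Fin K' → Fin N' → Fin n → Y),
      KeyedReliable W c c' (fun k k' => candidateDec E E' I (c k) (c' k')) ε := by
  obtain ⟨c, hc, hcy⟩ := exists_codebooks_one (F := F) hW hP₁ hP₂ hN he hE hF hI hq ht hK
  obtain ⟨c', hc'⟩ := exists_codebooks_two (E := E) (F' := F') hW hP₂ hN' hE' hF' hq0 hq' hc hK'
  have hNr : (0 : ℝ) < N := by exact_mod_cast hN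
  have hNr' : (0 : ℝ) < N' := by exact_mod_cast hN'
  refine ⟨c, c', fun x => ?_, fun y => ⟨fun k => confusionTwo W E F y (c k), fun k => ?_, ?_, ?_⟩⟩
  · obtain ⟨G, h0, h1, h2⟩ := hc' x
    refine ⟨G, h0, by rw [Fintype.card_fin, mul_comm]; exact h1, fun k k' => ?_⟩
    have h3 := h2 k k'
    rw [confusionOne, div_le_iff₀ hNr'] at h3
    rw [Fintype.card_fin, mul_comm]
    refine le_trans (sum_le_sum fun m _ => prob_mono (piW_channel_mem hW _ _) fun z hz => ?_) h3
    rcases badOne_decideVerdict hz with h | ⟨m₁, hm₁, h | ⟨m', hne, hm', h⟩⟩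
    · exact Or.inl (Or.inl h)
    · by_cases h' : E' (c' k' m) z
      · exact Or.inl (Or.inr ⟨m₁, h, (hsep _ _ _ ((hm₁ m₁).2 rfl) h').1⟩)
      · exact Or.inl (Or.inl h')
    · exact Or.inr ⟨m', hne, m₁, hm₁, (hsep _ _ _ ((hm₁ m₁).2 rfl) hm').2 h⟩
  · exact (sum_div_nonneg_le_one (fun m => prob_nonneg (piW_channel_mem hW _ _) _)
      fun m => prob_le_one (piW_channel_mem hW _ _) _).1
  · rw [Fintype.card_fin, mul_comm]
    exact hcy y
  · intro k k'
    rw [Fintype.card_fin]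
    refine le_trans ?_ (mul_div_cancel₀ _ hNr.ne').ge
    refine sum_le_sum fun m _ => prob_mono (piW_channel_mem hW _ _) fun z hz => ?_
    rcases badTwo_decideVerdict hz with h | ⟨m', hne, hm', m₂, hm₂⟩
    · exact Or.inl h
    · exact Or.inr ⟨m', hne, (hsep _ _ _ hm' hm₂).1⟩

end KeyedCodebooks

/-! ### Parameters for the random codes and the bound for `rateRegion₁` -/

section InnerBound

open Filter Topology

variable {X Y Z : Type*} [Fintype X] [Fintype Y] [Fintype Z]

theorem prod_mem_stdSimplex {A B : Type*} [Fintype A] [Fintype B] {p : A → ℝ} {v : A → B → ℝ}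
    (hp : p ∈ stdSimplex ℝ A) (hv : ∀ a, v a ∈ stdSimplex ℝ B) :
    (fun q : A × B => p q.1 * v q.1 q.2) ∈ stdSimplex ℝ (A × B) := by
  refine ⟨fun q => mul_nonneg (hp.1 _) ((hv _).1 _), ?_⟩
  rw [Fintype.sum_prod_type]
  simp only [← mul_sum, (hv _).2, mul_one, hp.2]

theorem avg_outProb_not_explainedTwo_le {W : X → Y → Z → ℝ} (hW : IsMAC W) {P₁ : X → ℝ}
    (hP₁ : P₁ ∈ stdSimplex ℝ X) {η : ℝ} (h0 : 0 ≤ η) (h1 : η ≤ 2) {n : ℕ} (hn : n ≠ 0)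
    (y : Fin n → Y) :
    avg (piW fun _ => P₁) (fun x => outProb W x y fun z => ¬ ExplainedTwo W P₁ η x z)
      ≤ 2 * (Fintype.card Y * (Fintype.card X * Fintype.card Z))
        * Real.exp (-(n * (η ^ 2 / 4))) := by
  have hw : ∀ y, (fun q : X × Z => P₁ q.1 * W q.1 y q.2) ∈ stdSimplex ℝ (X × Z) := fun y =>
    prod_mem_stdSimplex hP₁ fun x => hW x y
  have h := prob_not_typical_le hw h0 h1 y hn
  rw [Fintype.card_prod] at h
  push_cast at h
  refine le_trans ?_ h
  simp only [outProb]
  rw [prob_piW_pair (fun _ : Fin n => P₁) (fun t x => W x (y t))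
    fun x z => ¬ ExplainedTwo W P₁ η x z]
  exact prob_mono (piW_mem fun t => hw (y t)) fun c hc ht => hc ⟨y, ht⟩

theorem avg_outProb_not_explainedOne_le {W : X → Y → Z → ℝ} (hW : IsMAC W) {P₂ : Y → ℝ}
    (hP₂ : P₂ ∈ stdSimplex ℝ Y) {η : ℝ} (h0 : 0 ≤ η) (h1 : η ≤ 2) {n : ℕ} (hn : n ≠ 0)
    (x : Fin n → X) :
    avg (piW fun _ => P₂) (fun y => outProb W x y fun z => ¬ ExplainedOne W P₂ η y z)
      ≤ 2 * (Fintype.card X * (Fintype.card Y * Fintype.card Z))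
        * Real.exp (-(n * (η ^ 2 / 4))) :=
  avg_outProb_not_explainedTwo_le (W := fun y x => W x y) (fun y x => hW x y) hP₂ h0 h1 hn x

set_option maxHeartbeats 1000000 in
/-- Random codes for the rates of the inner bound, keyed by exponentially many keys. -/
theorem eventually_exists_keyedReliable {W : X → Y → Z → ℝ} (hW : IsMAC W) {P₁ : X → ℝ}
    {P₂ : Y → ℝ} (hP₁ : P₁ ∈ stdSimplex ℝ X) (hP₂ : P₂ ∈ stdSimplex ℝ Y) {R : ℝ × ℝ}
    (hR : R ∈ rateRegion₁ W P₁ P₂) {ξ : ℝ} (hξ : 0 < ξ) :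
    ∃ γ > (0 : ℝ), ∀ ε > 0, ∀ᶠ n : ℕ in atTop, ∀ K₁ K₂ : ℕ, (n : ℝ) ^ 2 ≤ K₁ → (n : ℝ) ^ 2 ≤ K₂ →
      (K₁ : ℝ) ≤ (2 : ℝ) ^ (n * γ) → ∃ (N₁ N₂ : ℕ) (e₁ : Fin K₁ → Fin N₁ → Fin n → X)
        (e₂ : Fin K₂ → Fin N₂ → Fin n → Y)
        (d : Fin K₁ → Fin K₂ → (Fin n → Z) → Verdict (Fin N₁) (Fin N₂)),
        (2 : ℝ) ^ (n * max 0 (R.1 - ξ)) ≤ N₁ ∧ (2 : ℝ) ^ (n * max 0 (R.2 - ξ)) ≤ N₂ ∧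
        KeyedReliable W e₁ e₂ d ε := by
  obtain ⟨η, hη, hη1, hsep⟩ := exists_separation hR (half_pos hξ)
  -- D dominates both exponents of n + 1 in the counting of types, for the pairs (x, z) and (y, (x,
  -- z)); C dominates the constants of the three typicality estimates.
  set D : ℕ := Fintype.card X * Fintype.card Z
    + Fintype.card Y * (Fintype.card X * Fintype.card Z) with hD
  set C : ℝ := 2 * (Fintype.card Y * (Fintype.card X * Fintype.card Z))
    + 2 * (Fintype.card X * (Fintype.card Y * Fintype.card Z))
    + 2 * (Fintype.card X * Fintype.card Y) with hC
  set L : ℝ := C + 2 ^ D with hL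
  have hC0 : 0 ≤ C := by positivity
  have hL0 : 0 < L := by positivity
  have hlog : 0 < Real.log 2 := Real.log_pos one_lt_two
  -- The first term is the exponent of atypicality in base 2, the second the gap between the rates R
  -- − ξ and the information thresholds R − ξ/2. Allowing 2^(nβ/2) keys leaves half of this
  -- exponent.
  set β : ℝ := min (η ^ 2 / 4 / Real.log 2) (ξ / 2) with hβ
  have hβ0 : 0 < β := lt_min (by positivity) (by positivity)
  refine ⟨β / 2, by positivity, fun ε hε => ?_⟩
  have hlim : Tendsto (fun n : ℕ => (3 * L) * ((n : ℝ) ^ (D + 2) * (2 : ℝ) ^ (-(n * (β / 2)))))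
      atTop (𝓝 0) := by
    simpa using (tendsto_pow_mul_two_rpow_neg (half_pos hβ0) (D + 2)).const_mul (3 * L)
  filter_upwards [hlim.eventually (ge_mem_nhds (by positivity : 0 < ε / 4)),
    eventually_ge_atTop 4,
    eventually_pow_mul_exp_lt_one (Fintype.card X) (by norm_num : (0 : ℝ) < 1 / 2),
    eventually_pow_mul_exp_lt_one (Fintype.card X) (half_pos hε),
    eventually_pow_mul_exp_lt_one (Fintype.card Y) (half_pos hε)]
    with n hsmall hn4 eX eX' eY K₁ K₂ hK₁ hK₂ hKγ
  have hn : n ≠ 0 := by omega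
  have hn4' : (4 : ℝ) ≤ n := by exact_mod_cast hn4
  have hnD : (1 : ℝ) ≤ (n : ℝ) ^ D := one_le_pow₀ (by linarith)
  set e : ℝ := L * (n : ℝ) ^ D * (2 : ℝ) ^ (-(n * β)) with he
  have he0 : 0 < e := by positivity
  have htyp : ∀ c : ℝ, 0 ≤ c → c ≤ C → c * Real.exp (-(n * (η ^ 2 / 4))) ≤ e := by
    intro c hc0 hcC
    have h1 : Real.exp (-(n * (η ^ 2 / 4))) ≤ (2 : ℝ) ^ (-(n * β)) := by
      rw [Real.rpow_def_of_pos two_pos]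
      refine Real.exp_le_exp.2 ?_
      have h2 : β * Real.log 2 ≤ η ^ 2 / 4 := (le_div_iff₀ hlog).1 (min_le_left _ _)
      nlinarith
    refine mul_le_mul ?_ h1 (Real.exp_pos _).le (by positivity)
    calc c ≤ L := hcC.trans (by rw [hL]; linarith [pow_pos (two_pos (α := ℝ)) D])
      _ ≤ L * (n : ℝ) ^ D := le_mul_of_one_le_right hL0.le hnD
  have hrate : ∀ ρ : ℝ, (((⌊(2 : ℝ) ^ (n * (ρ - ξ))⌋₊ + 1 : ℕ) : ℝ) - 1)
      * (((n : ℝ) + 1) ^ D * (2 : ℝ) ^ (-(n * (ρ - ξ / 2)))) ≤ e := by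
    intro ρ
    have h1 : (((⌊(2 : ℝ) ^ (n * (ρ - ξ))⌋₊ + 1 : ℕ) : ℝ) - 1) ≤ (2 : ℝ) ^ (n * (ρ - ξ)) := by
      push_cast
      linarith [Nat.floor_le (by positivity : 0 ≤ (2 : ℝ) ^ (n * (ρ - ξ)))]
    calc _ ≤ (2 : ℝ) ^ (n * (ρ - ξ)) * (((n : ℝ) + 1) ^ D * (2 : ℝ) ^ (-(n * (ρ - ξ / 2)))) :=
          mul_le_mul_of_nonneg_right h1 (by positivity)
      _ = ((n : ℝ) + 1) ^ D * (2 : ℝ) ^ (-(n * (ξ / 2))) := by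
          rw [mul_left_comm, ← Real.rpow_add two_pos]
          ring_nf
      _ ≤ (2 ^ D * (n : ℝ) ^ D) * (2 : ℝ) ^ (-(n * β)) := by
          refine mul_le_mul ?_ ?_ (by positivity) (by positivity)
          · rw [← mul_pow]
            exact pow_le_pow_left₀ (by positivity) (by linarith) D
          · refine Real.rpow_le_rpow_of_exponent_le one_le_two ?_
            have : β ≤ ξ / 2 := min_le_right _ _
            nlinarith
      _ ≤ e := by
          refine mul_le_mul_of_nonneg_right (mul_le_mul_of_nonneg_right ?_ (by positivity))
            (by positivity)
          rw [hL]; linarith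
  have hpow : ∀ {k : ℕ}, k ≤ D → ∀ θ : ℝ, ((n : ℝ) + 1) ^ k * (2 : ℝ) ^ (-(n * θ))
      ≤ ((n : ℝ) + 1) ^ D * (2 : ℝ) ^ (-(n * θ)) := fun hk θ =>
    mul_le_mul_of_nonneg_right (pow_le_pow_right₀ (by linarith) hk) (by positivity)
  have hsize : ∀ ρ : ℝ, (2 : ℝ) ^ (n * max 0 (ρ - ξ))
      ≤ ((⌊(2 : ℝ) ^ (n * (ρ - ξ))⌋₊ + 1 : ℕ) : ℝ) := by
    intro ρ
    rcases max_cases 0 (ρ - ξ) with ⟨h, -⟩ | ⟨h, -⟩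
    · rw [h, mul_zero, Real.rpow_zero]
      exact_mod_cast Nat.le_add_left _ _
    · rw [h]
      push_cast
      exact (Nat.lt_floor_add_one _).le
  have hkey : (K₁ : ℝ) * (((n : ℝ) ^ 2 + 2) * e) ≤ ε / 4 := by
    calc (K₁ : ℝ) * (((n : ℝ) ^ 2 + 2) * e)
        ≤ (2 : ℝ) ^ (n * (β / 2)) * ((3 * (n : ℝ) ^ 2) * e) :=
          mul_le_mul hKγ (mul_le_mul_of_nonneg_right (by nlinarith only [hn4']) he0.le) (by positivity)
            (by positivity)
      _ = (3 * L) * ((n : ℝ) ^ (D + 2) * (2 : ℝ) ^ (-(n * (β / 2)))) := by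
          have : (2 : ℝ) ^ (-(n * (β / 2))) = (2 : ℝ) ^ (n * (β / 2)) * (2 : ℝ) ^ (-(n * β)) := by
            rw [← Real.rpow_add two_pos]; ring_nf
          rw [this, he]; ring
      _ ≤ ε / 4 := hsmall
  have hn16 : (16 : ℝ) ≤ (n : ℝ) ^ 2 := by nlinarith only [hn4']
  have hK1 : (1 : ℝ) ≤ K₁ := by linarith only [hK₁, hn16]
  clear_value e
  have h4e : 4 * e ≤ ε / 4 := by
    have h1 : (((n : ℝ) ^ 2 + 2) * e) ≤ K₁ * (((n : ℝ) ^ 2 + 2) * e) :=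
      le_mul_of_one_le_left (by positivity) hK1
    nlinarith only [h1, hkey, he0, mul_le_mul_of_nonneg_right hn16 he0.le]
  have hexp4 : (Fintype.card X : ℝ) ^ n * Real.exp (4 - (n : ℝ) ^ 2) ≤ 1 / 2 := by
    have h1 : Real.exp (4 - (n : ℝ) ^ 2)
        ≤ Real.exp (-(1 / 2 * (n : ℝ) ^ 2)) * Real.exp (-1) := by
      rw [← Real.exp_add]
      exact Real.exp_le_exp.2 (by linarith only [hn16])
    have h2 : Real.exp (-1) ≤ 1 / 2 := by
      rw [Real.exp_neg, one_div]
      exact inv_anti₀ two_pos (by linarith [Real.add_one_le_exp (1 : ℝ)])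
    calc _ ≤ (Fintype.card X : ℝ) ^ n * (Real.exp (-(1 / 2 * (n : ℝ) ^ 2)) * Real.exp (-1)) :=
          mul_le_mul_of_nonneg_left h1 (by positivity)
      _ = ((Fintype.card X : ℝ) ^ n * Real.exp (-(1 / 2 * (n : ℝ) ^ 2))) * Real.exp (-1) := by ring
      _ ≤ 1 * (1 / 2) := mul_le_mul (eX _ le_rfl).le h2 (Real.exp_pos _).le one_pos.le
      _ = 1 / 2 := one_mul _
  have hunion : ∀ (B K : ℕ) (s : ℝ), s ≤ ε / 4 →
      (B : ℝ) ^ n * Real.exp (-(ε / 2 * K)) < 1 →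
      (B : ℝ) ^ n * Real.exp (2 * (K * s) - K * ε) < 1 := fun B K s hs h => by
    refine lt_of_le_of_lt (mul_le_mul_of_nonneg_left (Real.exp_le_exp.2 ?_) (by positivity)) h
    nlinarith only [mul_le_mul_of_nonneg_left hs (Nat.cast_nonneg (α := ℝ) K)]
  obtain ⟨c, c', h⟩ := exists_keyedReliable (n := n) hW hP₁ hP₂
    (E := ExplainedTwo W P₁ η) (E' := ExplainedOne W P₂ η) (I := Typical (fun _ => P₂) η)
    (F := fun x z => R.1 - ξ / 2 ≤ empInfo x z)
    (F' := fun y x z => R.2 - ξ / 2 ≤ empInfo y fun t => (x t, z t)) (hsep n hn)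
    -- Adding 1 keeps a message even when R − ξ is negative; only N − 1 competitors enter the union
    -- bound, so the estimate `hrate` needs no sign condition.
    (N := ⌊(2 : ℝ) ^ (n * (R.1 - ξ))⌋₊ + 1) (N' := ⌊(2 : ℝ) ^ (n * (R.2 - ξ))⌋₊ + 1)
    (Nat.succ_pos _) (Nat.succ_pos _) (e := e)
    (q := ((n : ℝ) + 1) ^ D * (2 : ℝ) ^ (-(n * (R.1 - ξ / 2))))
    (q' := ((n : ℝ) + 1) ^ D * (2 : ℝ) ^ (-(n * (R.2 - ξ / 2)))) (t := (n : ℝ) ^ 2) (ε := ε)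
    he0
    (fun y => (avg_outProb_not_explainedTwo_le hW hP₁ hη.le (by linarith) hn y).trans
      (htyp _ (by positivity) (by rw [hC]; nlinarith [
        (by positivity : (0 : ℝ) ≤ 2 * (Fintype.card X * (Fintype.card Y * Fintype.card Z))),
        (by positivity : (0 : ℝ) ≤ 2 * ((Fintype.card X : ℝ) * Fintype.card Y))])))
    (fun x => (avg_outProb_not_explainedOne_le hW hP₂ hη.le (by linarith) hn x).trans
      (htyp _ (by positivity) (by rw [hC]; nlinarith [
        (by positivity : (0 : ℝ) ≤ 2 * (Fintype.card Y * (Fintype.card X * Fintype.card Z))),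
        (by positivity : (0 : ℝ) ≤ 2 * ((Fintype.card X : ℝ) * Fintype.card Y))])))
    (fun x => (prob_not_typical_le (fun _ => hP₂) hη.le (by linarith) x hn).trans
      (htyp _ (by positivity) (by rw [hC]; nlinarith [
        (by positivity : (0 : ℝ) ≤ 2 * (Fintype.card X * (Fintype.card Y * Fintype.card Z))),
        (by positivity : (0 : ℝ) ≤ 2 * (Fintype.card Y * (Fintype.card X * Fintype.card Z)))])))
    (fun z => (prob_empInfo_ge_le hP₁ hn z _).trans (hpow (by omega) _))
    (fun x z => (prob_empInfo_ge_le hP₂ hn (fun t => (x t, z t)) _).trans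
      (hpow (by rw [Fintype.card_prod]; omega) _))
    (by positivity) (hrate R.1) (hrate R.2) hexp4 (K := K₁) (K' := K₂)
    (hunion _ K₁ _ h4e (eY K₁ hK₁)) (hunion _ K₂ _ hkey (eX' K₂ hK₂))
  exact ⟨_, _, c, c', _, hsize R.1, hsize R.2, h⟩

theorem mem_capacityRegion_of_mem_rateRegion₁ {W : X → Y → Z → ℝ} (hW : IsMAC W) {r : ℝ × ℝ}
    (hr : Achievable W r) (hr₁ : 0 < r.1) (hr₂ : 0 < r.2) {P₁ : X → ℝ}
    {P₂ : Y → ℝ} (hP₁ : P₁ ∈ stdSimplex ℝ X) (hP₂ : P₂ ∈ stdSimplex ℝ Y) {R : ℝ × ℝ}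
    (hR : R ∈ rateRegion₁ W P₁ P₂) : R ∈ capacityRegion W := by
  have hξ : ∀ ξ > 0, (max 0 (R.1 - ξ), max 0 (R.2 - ξ)) ∈ capacityRegion W := by
    intro ξ hξ
    set S : ℝ × ℝ := (max 0 (R.1 - ξ), max 0 (R.2 - ξ)) with hS
    have hS₁ : 0 ≤ S.1 := le_max_left _ _
    have hS₂ : 0 ≤ S.2 := le_max_left _ _
    obtain ⟨γ, hγ, h⟩ := eventually_exists_keyedReliable hW hP₁ hP₂ hR hξ
    have ht : Tendsto (fun t : ℝ => t • r + (1 - t) • S) (𝓝[>] 0) (𝓝 S) := by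
      have : Continuous fun t : ℝ => t • r + (1 - t) • S := by fun_prop
      simpa using this.continuousWithinAt (s := Set.Ioi 0) (x := 0).tendsto
    refine isClosed_closure.mem_of_tendsto ht ?_
    -- The condition κ < γ/(r₁+γ) says κ r₁ < (1−κ)γ: the prefix carries few enough keys of user 1.
    filter_upwards [Ioo_mem_nhdsGT (zero_lt_one (α := ℝ)),
      Ioo_mem_nhdsGT (by positivity : 0 < γ / (r.1 + γ))] with κ ⟨h0, h1⟩ ⟨_, h2⟩
    have h1' : 0 ≤ 1 - κ := by linarith
    rw [lt_div_iff₀ (by positivity)] at h2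
    exact (hr.attainable_of_keyed hW hr₁ hr₂ hS₁ hS₂ hγ h h0 h1 (by linarith)).mem_capacityRegion
      hW hr hr₁ hr₂ (add_nonneg (mul_nonneg h0.le hr₁.le) (mul_nonneg h1' hS₁))
      (add_nonneg (mul_nonneg h0.le hr₂.le) (mul_nonneg h1' hS₂))
  have ht : Tendsto (fun ξ : ℝ => (max 0 (R.1 - ξ), max 0 (R.2 - ξ))) (𝓝[>] 0) (𝓝 R) := by
    have : Continuous fun ξ : ℝ => (max 0 (R.1 - ξ), max 0 (R.2 - ξ)) := by fun_prop
    simpa [hR.1, hR.2.1] using this.continuousWithinAt (s := Set.Ioi 0) (x := 0).tendsto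
  exact isClosed_closure.mem_of_tendsto ht (eventually_mem_nhdsWithin.mono hξ)

end InnerBound

/-! ### Symmetry between the users -/

section UserSwap

variable {X Y Z : Type*}

/-- Exchange the roles of the two users. -/
def Output.swap {N₁ N₂ : ℕ} : Output N₁ N₂ → Output N₂ N₁
  | msgs m₁ m₂ => msgs m₂ m₁
  | blameOne => blameTwo
  | blameTwo => blameOne

/-- Exchange the roles of the two users. -/
def Code.swap {N₁ N₂ n : ℕ} (c : Code X Y Z N₁ N₂ n) : Code Y X Z N₂ N₁ n where
  enc₁ := c.enc₂
  enc₂ := c.enc₁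
  dec z := (c.dec z).swap

theorem Code.pe_swap [Fintype Z] (W : X → Y → Z → ℝ) {N₁ N₂ n : ℕ} (c : Code X Y Z N₁ N₂ n) :
    c.swap.pe (fun y x => W x y) = c.pe W := by
  have h0 : ∀ i j, c.swap.errHonest j i = c.errHonest i j := fun i j => by
    ext z
    simp only [Code.errHonest, Code.swap, Set.mem_ofPred_eq]
    rcases c.dec z with _ | _ | _ <;> simp [Output.swap, and_comm]
  have h1 : ∀ i, c.swap.errMalOne i = c.errMalTwo i := fun i => by
    ext z
    simp only [Code.errMalOne, Code.errMalTwo, Code.swap, Set.mem_ofPred_eq]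
    rcases c.dec z with _ | _ | _ <;> simp [Output.swap]
  have h2 : ∀ i, c.swap.errMalTwo i = c.errMalOne i := fun i => by
    ext z
    simp only [Code.errMalOne, Code.errMalTwo, Code.swap, Set.mem_ofPred_eq]
    rcases c.dec z with _ | _ | _ <;> simp [Output.swap]
  have e0 : c.swap.peHonest (fun y x => W x y) = c.peHonest W := by
    simp only [Code.peHonest, h0]
    rw [sum_comm, mul_comm (N₁ : ℝ)]
    rfl
  have e1 : c.swap.peMalOne (fun y x => W x y) = c.peMalTwo W := by
    simp only [Code.peMalOne, Code.peMalTwo, h1]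
    rfl
  have e2 : c.swap.peMalTwo (fun y x => W x y) = c.peMalOne W := by
    simp only [Code.peMalOne, Code.peMalTwo, h2]
    rfl
  rw [Code.pe, Code.pe, e0, e1, e2, max_comm (c.peMalTwo W)]

theorem Achievable.swap [Fintype Z] {W : X → Y → Z → ℝ} {R : ℝ × ℝ} (hR : Achievable W R) :
    Achievable (fun y x => W x y) R.swap := by
  obtain ⟨h1, h2, c, hc⟩ := hR
  refine ⟨h2, h1, fun n => (c n).swap, hc.congr fun n => ?_⟩
  exact ((c n).pe_swap W).symm

theorem swap_mem_capacityRegion [Fintype Z] {W : X → Y → Z → ℝ} {R : ℝ × ℝ}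
    (hR : R ∈ capacityRegion W) : R.swap ∈ capacityRegion fun y x => W x y :=
  map_mem_closure continuous_swap hR fun _ h => h.swap

/-- Exchange the roles of the two users in the outcome space. -/
def Joint.swapEquiv : Joint X Y Z ≃ Joint Y X Z where
  toFun ω := (ω.2.1, ω.1, ω.2.2.2.1, ω.2.2.1, ω.2.2.2.2)
  invFun ω := (ω.2.1, ω.1, ω.2.2.2.1, ω.2.2.1, ω.2.2.2.2)
  left_inv _ := rfl
  right_inv _ := rfl

theorem law_comp_equiv {Ω Ω' A : Type*} [Fintype Ω] [Fintype Ω'] (e : Ω ≃ Ω') (p : Ω' → ℝ)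
    (f : Ω → A) : law (fun ω => p (e ω)) f = law p fun ω => f (e.symm ω) := by
  funext a
  simp only [law]
  rw [← Equiv.sum_comp e]
  simp

variable [Fintype X] [Fintype Y] [Fintype Z]

open Joint in
theorem comp_swapEquiv_mem_attackSet {W : X → Y → Z → ℝ} {P₁ : X → ℝ} {P₂ : Y → ℝ}
    {p : Joint Y X Z → ℝ} (hp : p ∈ attackSet (fun y x => W x y) P₂ P₁) :
    (fun ω => p (swapEquiv ω)) ∈ attackSet W P₁ P₂ := by
  obtain ⟨h0, ⟨Q, hQ, h1⟩, ⟨Q', hQ', h2⟩⟩ := hp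
  refine ⟨⟨fun ω => h0.1 _, ?_⟩, ⟨Q', hQ', fun x y z => ?_⟩, ⟨Q, hQ, fun x y z => ?_⟩⟩
  · rw [Equiv.sum_comp swapEquiv p]
    exact h0.2
  · rw [law_comp_equiv, mul_comm (P₁ x), ← h2 y x z]
    exact law_comp_injective p (fun ω => (rX' ω, rY ω, rZ ω)) (e := fun q => (q.2.1, q.1, q.2.2))
      (fun q r => by simp +contextual [Prod.ext_iff]) (y, x, z)
  · rw [law_comp_equiv, mul_comm (Q x), ← h1 y x z]
    exact law_comp_injective p (fun ω => (rX ω, rY' ω, rZ ω)) (e := fun q => (q.2.1, q.1, q.2.2))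
      (fun q r => by simp +contextual [Prod.ext_iff]) (y, x, z)

open Joint in
theorem swap_mem_rateRegion₁ {W : X → Y → Z → ℝ} {P₁ : X → ℝ} {P₂ : Y → ℝ} {R : ℝ × ℝ}
    (hR : R ∈ rateRegion₂ W P₁ P₂) : R.swap ∈ rateRegion₁ (fun y x => W x y) P₂ P₁ := by
  obtain ⟨h1, h2, h3, h4⟩ := hR
  refine ⟨h2, h1, fun p hp => ?_, fun p hp hi => ?_⟩
  · have := h4 _ (comp_swapEquiv_mem_attackSet hp)
    simp only [mutualInfo, law_comp_equiv] at this ⊢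
    exact this
  · have := h3 _ (comp_swapEquiv_mem_attackSet hp) fun x y => by
      simp only [law_comp_equiv]
      have h := hi y x
      rw [mul_comm] at h
      rw [← law_comp_injective p (fun ω => (rX ω, rY ω)) Prod.swap_injective (y, x)] at h
      exact h
    simp only [condMutualInfo, law_comp_equiv] at this ⊢
    exact this

end UserSwap

end

theorem theorem2 {X Y Z : Type*} [Fintype X] [Fintype Y] [Fintype Z]
    (W : X → Y → Z → ℝ) (hW : IsMAC W)
    (hC : (interior (capacityRegion W)).Nonempty) :
    closedConvexHull ℝ
        (⋃ P₁ ∈ stdSimplex ℝ X, ⋃ P₂ ∈ stdSimplex ℝ Y, rateRegion₁ W P₁ P₂ ∪ rateRegion₂ W P₁ P₂)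
      ⊆ capacityRegion W := by
  obtain ⟨r, hr, hr₁, hr₂⟩ := exists_achievable_pos hC
  refine closedConvexHull_min ?_ (convex_capacityRegion hW hr hr₁ hr₂) isClosed_closure
  simp only [Set.iUnion_subset_iff]
  rintro P₁ hP₁ P₂ hP₂ R (hR | hR)
  · exact mem_capacityRegion_of_mem_rateRegion₁ hW hr hr₁ hr₂ hP₁ hP₂ hR
  · exact swap_mem_capacityRegion (mem_capacityRegion_of_mem_rateRegion₁ (fun y x => hW x y)
      hr.swap hr₂ hr₁ hP₂ hP₁ (swap_mem_rateRegion₁ hR))
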